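/- **Setting.** Let $(M,d)$ be a locally compact separable metric space and $\mu$ a Radon measure on $M$ with full support; write $B(x,r)$ for the open ball and $V(x,r)=\mu(B(x,r))$. A family of non-decreasing functions $\Psi_x:(0,\infty)\to(0,\infty)$ satisfies the weak scaling property uniformly with $(a_1,a_2)$, where $0<a_1\le a_2<\infty$, if there are constants $c_1,c_2>0$, independent of $x$, such that $c_1(R/r)^{a_1}\le \Psi_x(R)/\Psi_x(r)\le c_2(R/r)^{a_2}$ for all $0<r\le R$. Assume that $\{V(x,\cdot)\}_{x\in M}$ satisfies it uniformly with $(d_1,d_2)$. Let $S=(S_t)_{t\ge0}$ be a subordinator (a non-decreasing real-valued Lévy process with $S_0=0$) without drift, with Laplace exponent $\phi$, i.e. $\mathbb E e^{-\lambda S_t}=e^{-t\phi(\lambda)}$ and $\phi(\lambda)=\int_0^\infty(1-e^{-\lambda s})\,\nu(ds)$ with $\int_0^\infty (1\wedge s)\,\nu(ds)<\infty$, and assume that $\phi$ satisfies the weak scaling property with $(\beta_1,\beta_2)$, where $0<\beta_1\le\beta_2<1$. Let $X$ be a strong Markov process on $M$ with infinite lifetime which has a transition density function $q(t,x,y)$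 with respect to $\mu$, and let $$p(t,x,y)=\int_0^\infty q(r,x,y)\,d_r\mathbb P(S_r\ge t)\in[0,\infty],\qquad t>0,\ x,y\in M .$$ Let $\Phi:[0,\infty)\to[0,\infty)$ be strictly increasing with $\Phi(0)=0$ and with the weak scaling property with $(\alpha_1,\alpha_2)$, and let $\Phi^{-1}(s)=\inf\{r\ge0:\Phi(r)\ge s\}$. Assume that one of the following two conditions holds. * (Jump case) There are constants $c_1,c_2>0$ such that for all $t>0$ and $x,y\in M$ $$c_1 J\le q(t,x,y)\le c_2 J,\qquad J=\frac1{V(x,\Phi^{-1}(t))}\wedge\frac{t}{V(x,d(x,y))\,\Phi(d(x,y))},$$ where the second term of the minimum is $+\infty$ if $x=y$. * (Diffusion case) $M$ is connected and satisfies the chain condition (there is $C>0$ such that for all $x,y\in M$ and $n\ge1$ there are $x=x_0,x_1,\dots,x_n=y$ in $M$ with $d(x_i,x_{i+1})\le C\,d(x,y)/n$ for all $i<n$), $X$ has continuous paths, $\alpha_1>1$, and there are constants $c_1,c_2,c_3,c_4>0$ such that for all $t>0$ and $x,y\in M$ $$\frac{c_1}{V(x,\Phi^{-1}(t))}e^{-c_2m(t,d(x,y))}\le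 q(t,x,y)\le \frac{c_3}{V(x,\Phi^{-1}(t))}e^{-c_4m(t,d(x,y))},$$ where $m(t,r)>0$ for $t,r>0$, $m(\cdot,r)$ is non-increasing for each $r>0$, there are constants $c_5,c_6>0$ with $c_5\,\Phi(r/m(t,r))\le t/m(t,r)\le c_6\,\Phi(r/m(t,r))$ for all $t,r>0$, and $m(t,0)=0$. **Conclusion.** Below, $p\simeq f$ on a set of triples $(t,x,y)$ means that there are constants $C_1,C_2>0$, independent of $(t,x,y)$, with $C_1f\le p\le C_2f$ on that set. 1. If $d_2<\alpha_1$, then for all $t>0$ and $x,y\in M$ with $\Phi(d(x,y))\phi(t^{-1})\le1$, $$p(t,x,y)\simeq\frac1{V(x,\Phi^{-1}(1/\phi(t^{-1})))}.$$ 2. If $d_1>\alpha_2$, then for all $t>0$ and $x\ne y$ with $\Phi(d(x,y))\phi(t^{-1})\le1$, $$p(t,x,y)\simeq\frac{\Phi(d(x,y))\,\phi(t^{-1})}{V(x,d(x,y))},$$ and $p(t,x,x)=\infty$ for all $t>0$, $x\in M$. 3. If $d_1=d_2=\alpha_1=\alpha_2$, then for all $t>0$ and $x\ne y$ with $\Phi(d(x,y))\phi(t^{-1})\le1$,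 $$p(t,x,y)\simeq\frac1{V(x,\Phi^{-1}(1/\phi(t^{-1})))}\,\log\Big(\frac{2}{\Phi(d(x,y))\,\phi(t^{-1})}\Big),$$ and $p(t,x,x)=\infty$ for all $t>0$, $x\in M$. -/

import Mathlib

open MeasureTheory ProbabilityTheory Set
open scoped NNReal ENNReal

noncomputable section

namespace TimeFractional

/-! ### Weak scaling, volume function, generalized inverse, chain condition -/

/-- A family of non-decreasing functions `Ψ x : (0,∞) → (0,∞)` satisfies the weak scaling property
with exponents `0 < a₁ ≤ a₂`, with constants independent of the member `x` of the family. -/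
structure WeakScalingUniformly {Λ : Type*} (Ψ : Λ → ℝ → ℝ) (a₁ a₂ : ℝ) : Prop where
  pos_left : 0 < a₁
  left_le_right : a₁ ≤ a₂
  pos : ∀ x r, 0 < r → 0 < Ψ x r
  mono : ∀ x, MonotoneOn (Ψ x) (Ioi 0)
  scaling : ∃ c₁ c₂ : ℝ, 0 < c₁ ∧ 0 < c₂ ∧ ∀ x r R, 0 < r → r ≤ R →
    c₁ * (R / r) ^ a₁ ≤ Ψ x R / Ψ x r ∧ Ψ x R / Ψ x r ≤ c₂ * (R / r) ^ a₂

/-- The weak scaling property of a single function. -/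
def WeakScaling (Ψ : ℝ → ℝ) (a₁ a₂ : ℝ) : Prop :=
  WeakScalingUniformly (fun _ : Unit => Ψ) a₁ a₂

/-- The volume `V(x, r) = μ(B(x, r))` of the open ball. -/
def vol {M : Type*} [MetricSpace M] [MeasurableSpace M] (μ : Measure M) (x : M) (r : ℝ) : ℝ :=
  μ.real (Metric.ball x r)

/-- The inverse `Φ⁻¹(s) = inf {r ≥ 0 : Φ(r) ≥ s}` of an increasing function on `[0,∞)`. It is the
ordinary inverse when `Φ` is a strictly increasing bijection of `[0,∞)`, and it also makes sense
when `Φ` jumps. -/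
def inv (Φ : ℝ → ℝ) (s : ℝ) : ℝ := sInf {r : ℝ | 0 ≤ r ∧ s ≤ Φ r}

/-- The chain condition for a metric space. -/
def ChainCondition (M : Type*) [MetricSpace M] : Prop :=
  ∃ C : ℝ, 0 < C ∧ ∀ (x y : M) (n : ℕ), 1 ≤ n → ∃ z : ℕ → M, z 0 = x ∧ z n = y ∧
    ∀ i < n, dist (z i) (z (i + 1)) ≤ C * (dist x y / n)

/-! ### Subordinators and their Laplace exponents -/

/-- `S` is a subordinator: a non-decreasing real-valued Lévy process started at `0`. -/
structure IsSubordinator {Ω : Type*} [MeasurableSpace Ω] (P : Measure Ω) (S : ℝ≥0 → Ω → ℝ) :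
    Prop where
  measurable : ∀ t, Measurable (S t)
  zero : ∀ᵐ ω ∂P, S 0 ω = 0
  mono : ∀ᵐ ω ∂P, Monotone fun t => S t ω
  rightCont : ∀ᵐ ω ∂P, ∀ t, ContinuousWithinAt (fun s => S s ω) (Ici t) t
  indep : HasIndepIncrements S P
  stationary : ∀ s t, IdentDistrib (fun ω => S (s + t) ω - S s ω) (S t) P P

/-- `φ` is the Laplace exponent of `S`, `E exp(-l S_t) = exp(-t φ(l))`, and `S` has no drift:
`φ(l) = ∫ (1 - exp(-l s)) ν(ds)` for a Lévy measure `ν` on `(0,∞)`. -/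
structure IsDriftlessLaplaceExponent {Ω : Type*} [MeasurableSpace Ω] (P : Measure Ω)
    (S : ℝ≥0 → Ω → ℝ) (φ : ℝ → ℝ) : Prop where
  laplace : ∀ (t : ℝ≥0) (l : ℝ), 0 < t → 0 < l →
    ∫ ω, Real.exp (-l * S t ω) ∂P = Real.exp (-(t : ℝ) * φ l)
  driftless : ∃ ν : Measure ℝ, ν (Iic 0) = 0 ∧ ∫⁻ s, ENNReal.ofReal (min 1 s) ∂ν < ∞ ∧
    ∀ l : ℝ, 0 < l → φ l = ∫ s, (1 - Real.exp (-l * s)) ∂ν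

/-- The function `r ↦ P(S_r ≥ t)` for `r ≥ 0`, extended by its value at `0` to `r < 0`. -/
def tail {Ω : Type*} [MeasurableSpace Ω] (P : Measure Ω) (S : ℝ≥0 → Ω → ℝ) (t r : ℝ) : ℝ :=
  P.real {ω | t ≤ S r.toNNReal ω}

theorem IsSubordinator.monotone_tail {Ω : Type*} [MeasurableSpace Ω] {P : Measure Ω}
    [IsProbabilityMeasure P] {S : ℝ≥0 → Ω → ℝ} (hS : IsSubordinator P S) (t : ℝ) :
    Monotone (tail P S t) := by
  intro a b hab
  refine ENNReal.toReal_mono (measure_ne_top _ _) (measure_mono_ae ?_)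
  filter_upwards [hS.mono] with ω hω h
  exact le_trans (show t ≤ S a.toNNReal ω from h) (hω (Real.toNNReal_mono hab))

/-- The fundamental solution `p(t, x, y) = ∫₀^∞ q(r, x, y) d_r P(S_r ≥ t)`, an integral with respect
to the Lebesgue–Stieltjes measure of `r ↦ P(S_r ≥ t)`, with values in `[0, ∞]`. -/
def fundamentalSolution {Ω : Type*} [MeasurableSpace Ω] {P : Measure Ω} [IsProbabilityMeasure P]
    {S : ℝ≥0 → Ω → ℝ} (hS : IsSubordinator P S) {M : Type*} (q : ℝ → M → M → ℝ)
    (t : ℝ) (x y : M) : ℝ≥0∞ :=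
  ∫⁻ r in Ioi 0, ENNReal.ofReal (q r x y) ∂(hS.monotone_tail t).stieltjesFunction.measure

/-! ### Strong Markov processes and heat kernels -/

/-- `X`, with laws `Q x` (`x ∈ M`) on `Ω`, is a strong Markov process with respect to `ℱ`, with
state space `M` and infinite lifetime: for every stopping time `τ`, every `A ∈ ℱ_τ`, every `s ≥ 0`
and every Borel set `B`,
`Q x (A, τ < ∞, X_{τ+s} ∈ B) = ∫_{A ∩ {τ < ∞}} Q (X_τ) (X_s ∈ B) dQ x`. -/
structure IsStrongMarkovProcess {M : Type*} [MetricSpace M] [MeasurableSpace M]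
    {Ω : Type*} {mΩ : MeasurableSpace Ω} (ℱ : Filtration ℝ≥0 mΩ) (Q : M → Measure Ω)
    (X : ℝ≥0 → Ω → M) : Prop where
  isProbabilityMeasure : ∀ x, IsProbabilityMeasure (Q x)
  progressive : IsStronglyProgressive ℱ X
  start : ∀ x, ∀ᵐ ω ∂Q x, X 0 ω = x
  measurable_law : ∀ (s : ℝ≥0) (B : Set M), MeasurableSet B →
    Measurable fun x => Q x {ω | X s ω ∈ B}
  strongMarkov : ∀ (x : M) (τ : Ω → WithTop ℝ≥0) (hτ : IsStoppingTime ℱ τ) (A : Set Ω),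
    MeasurableSet[hτ.measurableSpace] A → ∀ (s : ℝ≥0) (B : Set M), MeasurableSet B →
    Q x {ω | ω ∈ A ∧ τ ω ≠ ⊤ ∧ X ((τ ω).untopD 0 + s) ω ∈ B} =
      ∫⁻ ω in {ω | ω ∈ A ∧ τ ω ≠ ⊤}, Q (X ((τ ω).untopD 0) ω) {ω' | X s ω' ∈ B} ∂Q x

/-- `q(t, x, y)`, `t > 0`, is a transition density function (heat kernel) of `X` with respect to
`μ`. -/
structure IsHeatKernel {M : Type*} [MeasurableSpace M] {Ω : Type*} [MeasurableSpace Ω]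
    (μ : Measure M) (Q : M → Measure Ω) (X : ℝ≥0 → Ω → M) (q : ℝ → M → M → ℝ) : Prop where
  measurable : Measurable fun z : Ioi (0 : ℝ) × M × M => q z.1 z.2.1 z.2.2
  nonneg : ∀ t x y, 0 < t → 0 ≤ q t x y
  density : ∀ (t : ℝ≥0) (x : M) (B : Set M), 0 < t → MeasurableSet B →
    Q x {ω | X t ω ∈ B} = ∫⁻ y in B, ENNReal.ofReal (q t x y) ∂μ

/-! ### The two heat kernel conditions -/

/-- `1 / V(x, Φ⁻¹(t)) ∧ t / (V(x, d(x,y)) Φ(d(x,y)))`; the second term is `+∞` when `x = y`. -/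
def jumpProfile {M : Type*} [MetricSpace M] [MeasurableSpace M] (μ : Measure M) (Φ : ℝ → ℝ)
    (t : ℝ) (x y : M) : ℝ :=
  if dist x y = 0 then 1 / vol μ x (inv Φ t)
  else min (1 / vol μ x (inv Φ t)) (t / (vol μ x (dist x y) * Φ (dist x y)))

/-- Two-sided heat kernel estimates in the pure jump case. -/
def JumpEstimate {M : Type*} [MetricSpace M] [MeasurableSpace M] (μ : Measure M) (Φ : ℝ → ℝ)
    (q : ℝ → M → M → ℝ) : Prop :=
  ∃ c₁ c₂ : ℝ, 0 < c₁ ∧ 0 < c₂ ∧ ∀ (t : ℝ) (x y : M), 0 < t →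
    c₁ * jumpProfile μ Φ t x y ≤ q t x y ∧ q t x y ≤ c₂ * jumpProfile μ Φ t x y

/-- `m(t, r)` is strictly positive for `t, r > 0`, non-increasing in `t`, and determined up to
constants by `t / m(t,r) ≃ Φ(r / m(t,r))`; moreover `m(t, 0) = 0`. -/
structure IsStepFunction (Φ : ℝ → ℝ) (m : ℝ → ℝ → ℝ) : Prop where
  pos : ∀ t r, 0 < t → 0 < r → 0 < m t r
  antitone : ∀ r, 0 < r → AntitoneOn (fun t => m t r) (Ioi 0)
  scale : ∃ c₁ c₂ : ℝ, 0 < c₁ ∧ 0 < c₂ ∧ ∀ t r, 0 < t → 0 < r →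
    c₁ * Φ (r / m t r) ≤ t / m t r ∧ t / m t r ≤ c₂ * Φ (r / m t r)
  zero : ∀ t, 0 < t → m t 0 = 0

/-- Two-sided heat kernel estimates in the diffusion case. -/
def DiffusionEstimate {M : Type*} [MetricSpace M] [MeasurableSpace M] (μ : Measure M) (Φ : ℝ → ℝ)
    (q : ℝ → M → M → ℝ) : Prop :=
  ∃ m : ℝ → ℝ → ℝ, IsStepFunction Φ m ∧ ∃ c₁ c₂ c₃ c₄ : ℝ,
    0 < c₁ ∧ 0 < c₂ ∧ 0 < c₃ ∧ 0 < c₄ ∧ ∀ (t : ℝ) (x y : M), 0 < t →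
    c₁ / vol μ x (inv Φ t) * Real.exp (-c₂ * m t (dist x y)) ≤ q t x y ∧
    q t x y ≤ c₃ / vol μ x (inv Φ t) * Real.exp (-c₄ * m t (dist x y))

/-- The diffusion case: the space is connected and satisfies the chain condition, the lower scaling
exponent of `Φ` exceeds `1`, `X` has continuous paths, and the heat kernel satisfies the diffusion
estimates. -/
structure DiffusionCase {M : Type*} [MetricSpace M] [MeasurableSpace M] {Ω : Type*}
    [MeasurableSpace Ω] (μ : Measure M) (Q : M → Measure Ω) (X : ℝ≥0 → Ω → M) (Φ : ℝ → ℝ)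
    (α₁ : ℝ) (q : ℝ → M → M → ℝ) : Prop where
  connected : ConnectedSpace M
  chain : ChainCondition M
  one_lt : 1 < α₁
  continuous_paths : ∀ x, ∀ᵐ ω ∂Q x, Continuous fun t => X t ω
  estimate : DiffusionEstimate μ Φ q

/-- Two-sided comparison `p ≃ f` on the set of triples `(t, x, y)` satisfying `D`, with constants
independent of `(t, x, y)`. -/
def Comparable {M : Type*} (D : ℝ → M → M → Prop) (p : ℝ → M → M → ℝ≥0∞) (f : ℝ → M → M → ℝ) :
    Prop :=
  ∃ c₁ c₂ : ℝ, 0 < c₁ ∧ 0 < c₂ ∧ ∀ (t : ℝ) (x y : M), D t x y →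
    ENNReal.ofReal (c₁ * f t x y) ≤ p t x y ∧ p t x y ≤ ENNReal.ofReal (c₂ * f t x y)

end TimeFractional

end

/-!
Put `W(x, r) = V(x, Φ⁻¹(r))`, `a = Φ(d(x, y))` and `T = 1 / φ(t⁻¹)`. Both heat kernel conditions say
that, as a function of `r`, `q(r, x, y)` is at most of order `1 / W(x, a ∨ r)`, and is of order
`1 / W(x, r)` once `r` is at least of order `a`. On the other hand, Laplace transform bounds give
`P(S_r ≥ t) ≃ (r / T) ∧ 1`: on initial intervals `(0, r]` the measure `d_r P(S_r ≥ t)` is comparable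
to the uniform distribution on `(0, T]`. By the layer cake formula a comparison on initial intervals
extends to integrals of non-increasing functions, so that, whenever `a ≤ T`, `p(t, x, y)` is
comparable to the mean of `r ↦ 1 / W(x, a ∨ r)` over `(0, T]`. The three regimes are those of the
elementary integral of `(a ∨ r) ^ (-γ)`, with `γ < 1`, `γ > 1` and `γ = 1`.
-/

namespace TimeFractional

section AntitoneComparison

variable {μ ν : Measure ℝ} {a : ℝ} {f g : ℝ → ℝ}

theorem measure_le_of_measure_Ioc_le (h : ∀ r, 0 < r → a ≤ r → μ (Ioc 0 r) ≤ ν (Ioc 0 r))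
    {s : Set ℝ} (hs : s ⊆ Ioi 0) (hsup : ∀ r ∈ s, Ioc 0 (max a r) ⊆ s) : μ s ≤ ν s := by
  rcases s.eq_empty_or_nonempty with rfl | hne
  · simp only [measure_empty, le_refl]
  have : s.OrdConnected :=
    ⟨fun x hx y hy z hz => hsup y hy ⟨(hs hx).trans_le hz.1, hz.2.trans (le_max_right _ _)⟩⟩
  have := hne.to_subtype
  obtain ⟨u, hmono, hu⟩ := Filter.exists_seq_monotone_tendsto_atTop_atTop s
  have hs_eq : s = ⋃ n, Ioc 0 (max a (u n)) := by
    refine Subset.antisymm (fun x hx => ?_) (iUnion_subset fun n => hsup _ (u n).2)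
    obtain ⟨n, hn⟩ := (hu.eventually_ge_atTop ⟨x, hx⟩).exists
    exact mem_iUnion.2 ⟨n, hs hx, le_max_of_le_right hn⟩
  have hIoc : Monotone fun n => Ioc 0 (max a (u n : ℝ)) := fun m n hmn =>
    Ioc_subset_Ioc_right (max_le_max_left a (hmono hmn))
  rw [hs_eq, hIoc.measure_iUnion, hIoc.measure_iUnion]
  exact iSup_mono fun n => h _ ((hs (u n).2).trans_le (le_max_right _ _)) (le_max_left _ _)

theorem antitoneOn_comp_max (hg : AntitoneOn g (Ioi 0)) :
    AntitoneOn (fun r => g (max a r)) (Ioi 0) := fun _ hr _ hs hrs =>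
  hg (mem_Ioi.2 (lt_max_of_lt_right hr)) (mem_Ioi.2 (lt_max_of_lt_right hs))
    (max_le_max_left a hrs)

theorem lintegral_comp_max_mono (h : ∀ r, 0 < r → a ≤ r → μ (Ioc 0 r) ≤ ν (Ioc 0 r))
    (hg : AntitoneOn g (Ioi 0)) (hg0 : ∀ r, 0 < r → 0 ≤ g r) :
    ∫⁻ r in Ioi 0, ENNReal.ofReal (g (max a r)) ∂μ ≤
      ∫⁻ r in Ioi 0, ENNReal.ofReal (g (max a r)) ∂ν := by
  have hnn (ρ : Measure ℝ) : 0 ≤ᵐ[ρ.restrict (Ioi 0)] fun r => g (max a r) :=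
    (ae_restrict_iff' measurableSet_Ioi).2 <| .of_forall fun r hr =>
      hg0 _ (lt_max_of_lt_right hr)
  have hmeas (ρ : Measure ℝ) : AEMeasurable (fun r => g (max a r)) (ρ.restrict (Ioi 0)) :=
    aemeasurable_restrict_of_antitoneOn measurableSet_Ioi (antitoneOn_comp_max hg)
  rw [lintegral_eq_lintegral_meas_lt _ (hnn μ) (hmeas μ),
    lintegral_eq_lintegral_meas_lt _ (hnn ν) (hmeas ν)]
  refine lintegral_mono fun t => ?_
  rw [Measure.restrict_apply' measurableSet_Ioi, Measure.restrict_apply' measurableSet_Ioi]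
  refine measure_le_of_measure_Ioc_le h inter_subset_right ?_
  rintro r ⟨htr : t < g (max a r), hr : 0 < r⟩ s ⟨hs : 0 < s, hsr⟩
  exact ⟨htr.trans_le (hg (lt_max_of_lt_right hs) (lt_max_of_lt_right hr)
    (max_le (le_max_left a r) hsr)), hs⟩

end AntitoneComparison

section Mean

/-- The mean of `r ↦ 1 / W (a ∨ r)` over the interval `(0, T]`. With `W = V(x, Φ⁻¹(·))`,
`a = Φ(d(x, y))` and `T = 1 / φ(t⁻¹)` it is comparable to `p(t, x, y)` in all regimes. -/
noncomputable def meanInv (W : ℝ → ℝ) (a T : ℝ) : ℝ≥0∞ :=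
  ⨍⁻ r in Ioc 0 T, ENNReal.ofReal (1 / W (max a r)) ∂volume

variable {W q g : ℝ → ℝ} {a T c C k K : ℝ} {ν : Measure ℝ}

theorem meanInv_eq_lintegral_cond (W : ℝ → ℝ) (a T : ℝ) :
    meanInv W a T = ∫⁻ r in Ioi 0, ENNReal.ofReal (1 / W (max a r)) ∂volume[|Ioc 0 T] := by
  rw [meanInv, setLAverage_eq', ProbabilityTheory.cond, Measure.restrict_smul,
    Measure.restrict_restrict measurableSet_Ioi, inter_eq_self_of_subset_right Ioc_subset_Ioi_self]

theorem cond_Ioc_apply_Ioc (hT : 0 < T) (r : ℝ) :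
    volume[|Ioc 0 T] (Ioc 0 r) = ENNReal.ofReal (min (r / T) 1) := by
  rw [cond_apply measurableSet_Ioc, Ioc_inter_Ioc, sup_idem, Real.volume_Ioc, Real.volume_Ioc,
    sub_zero, sub_zero, inf_comm, mul_comm, ← div_eq_mul_inv, ← ENNReal.ofReal_div_of_pos hT,
    ← min_div_div_right hT.le, div_self hT.ne']

theorem antitoneOn_one_div (hW : MonotoneOn W (Ioi 0)) (hW0 : ∀ r, 0 < r → 0 < W r) :
    AntitoneOn (fun r => 1 / W r) (Ioi 0) := fun r hr _ hs hrs =>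
  one_div_le_one_div_of_le (hW0 r hr) (hW hr hs hrs)

theorem lintegral_le_meanInv (hW : MonotoneOn W (Ioi 0)) (hW0 : ∀ r, 0 < r → 0 < W r)
    (hT : 0 < T) (hC : 0 ≤ C) (hν : ∀ r, 0 ≤ r → ν (Ioc 0 r) ≤ ENNReal.ofReal (C * min (r / T) 1))
    (hK : 0 ≤ K) (hq : ∀ r, 0 < r → q r ≤ K / W (max a r)) :
    ∫⁻ r in Ioi 0, ENNReal.ofReal (q r) ∂ν ≤ ENNReal.ofReal (K * C) * meanInv W a T := by
  have hcmp : ∀ r, 0 < r → a ≤ r →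
      ν (Ioc 0 r) ≤ (ENNReal.ofReal C • volume[|Ioc 0 T]) (Ioc 0 r) := fun r hr _ => by
    rw [Measure.smul_apply, smul_eq_mul, cond_Ioc_apply_Ioc hT, ← ENNReal.ofReal_mul hC]
    exact hν r hr.le
  calc ∫⁻ r in Ioi 0, ENNReal.ofReal (q r) ∂ν
      ≤ ∫⁻ r in Ioi 0, ENNReal.ofReal K * ENNReal.ofReal (1 / W (max a r)) ∂ν :=
        setLIntegral_mono' measurableSet_Ioi fun r hr => by
          rw [← ENNReal.ofReal_mul hK, mul_one_div]
          exact ENNReal.ofReal_le_ofReal (hq r hr)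
    _ = ENNReal.ofReal K * ∫⁻ r in Ioi 0, ENNReal.ofReal (1 / W (max a r)) ∂ν :=
        lintegral_const_mul' _ _ ENNReal.ofReal_ne_top
    _ ≤ ENNReal.ofReal K * ∫⁻ r in Ioi 0, ENNReal.ofReal (1 / W (max a r))
          ∂(ENNReal.ofReal C • volume[|Ioc 0 T]) :=
        mul_le_mul_right (lintegral_comp_max_mono hcmp (antitoneOn_one_div hW hW0)
          fun r hr => (one_div_pos.2 (hW0 r hr)).le) _
    _ = ENNReal.ofReal (K * C) * meanInv W a T := by
        rw [Measure.restrict_smul, lintegral_smul_measure, smul_eq_mul, ← meanInv_eq_lintegral_cond,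
          ENNReal.ofReal_mul hK, mul_assoc]

theorem ofReal_mul_min_le_measure_Ioc_inter_Ioi (hT : 0 < T) (hc : 0 < c) (hC : 0 < C)
    (hν : ∀ r, 0 ≤ r → ENNReal.ofReal (c * min (r / T) 1) ≤ ν (Ioc 0 r) ∧
      ν (Ioc 0 r) ≤ ENNReal.ofReal (C * min (r / T) 1))
    (ha : 0 ≤ a) (haT : a ≤ T) {r : ℝ} (har : a ≤ r) :
    ENNReal.ofReal (c / 2 * min (r / T) 1) ≤ ν (Ioc 0 r ∩ Ioi (a / (2 * C / c))) := by
  set b := a / (2 * C / c) with hb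
  have hb0 : 0 ≤ b := by positivity
  have hCb : C * min (b / T) 1 ≤ c / 2 * min (r / T) 1 :=
    calc C * min (b / T) 1 ≤ C * (b / T) := by gcongr; exact min_le_left _ _
      _ = c / 2 * (a / T) := by rw [hb]; field_simp
      _ ≤ c / 2 * min (r / T) 1 := by
        gcongr
        exact le_min (by gcongr) ((div_le_one hT).2 haT)
  calc ENNReal.ofReal (c / 2 * min (r / T) 1)
      ≤ ENNReal.ofReal (c * min (r / T) 1 - C * min (b / T) 1) :=
        ENNReal.ofReal_le_ofReal (by linarith)
    _ = ENNReal.ofReal (c * min (r / T) 1) - ENNReal.ofReal (C * min (b / T) 1) :=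
        ENNReal.ofReal_sub _ (by positivity)
    _ ≤ ν (Ioc 0 r) - ν (Ioc 0 b) := tsub_le_tsub (hν r (ha.trans har)).1 (hν b hb0).2
    _ ≤ ν (Ioc 0 r \ Ioc 0 b) := le_measure_sdiff
    _ ≤ ν (Ioc 0 r ∩ Ioi b) := measure_mono fun s ⟨hs, hsb⟩ =>
        ⟨hs, not_le.1 fun h => hsb ⟨hs.1, h⟩⟩

theorem meanInv_le_lintegral (hW : MonotoneOn W (Ioi 0)) (hW0 : ∀ r, 0 < r → 0 < W r)
    (hT : 0 < T) (hc : 0 < c) (hC : 0 < C)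
    (hν : ∀ r, 0 ≤ r → ENNReal.ofReal (c * min (r / T) 1) ≤ ν (Ioc 0 r) ∧
      ν (Ioc 0 r) ≤ ENNReal.ofReal (C * min (r / T) 1))
    (ha : 0 ≤ a) (haT : a ≤ T) (hk : 0 ≤ k)
    (hq : ∀ r, 0 < r → a ≤ 2 * C / c * r → k / W r ≤ q r) :
    ENNReal.ofReal (k * (c / 2)) * meanInv W a T ≤ ∫⁻ r in Ioi 0, ENNReal.ofReal (q r) ∂ν := by
  set b := a / (2 * C / c)
  have hcmp : ∀ r, 0 < r → a ≤ r →
      (ENNReal.ofReal (c / 2) • volume[|Ioc 0 T]) (Ioc 0 r) ≤ ν.restrict (Ioi b) (Ioc 0 r) :=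
    fun r _ har => by
      rw [Measure.smul_apply, smul_eq_mul, cond_Ioc_apply_Ioc hT,
        ← ENNReal.ofReal_mul (by positivity), Measure.restrict_apply measurableSet_Ioc]
      exact ofReal_mul_min_le_measure_Ioc_inter_Ioi hT hc hC hν ha haT har
  calc ENNReal.ofReal (k * (c / 2)) * meanInv W a T
      = ENNReal.ofReal k * ∫⁻ r in Ioi 0, ENNReal.ofReal (1 / W (max a r))
          ∂(ENNReal.ofReal (c / 2) • volume[|Ioc 0 T]) := by
        rw [Measure.restrict_smul, lintegral_smul_measure, smul_eq_mul, ← meanInv_eq_lintegral_cond,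
          ENNReal.ofReal_mul hk, mul_assoc]
    _ ≤ ENNReal.ofReal k * ∫⁻ r in Ioi 0, ENNReal.ofReal (1 / W (max a r)) ∂ν.restrict (Ioi b) :=
        mul_le_mul_right (lintegral_comp_max_mono hcmp (antitoneOn_one_div hW hW0)
          fun r hr => (one_div_pos.2 (hW0 r hr)).le) _
    _ = ∫⁻ r in Ioi 0 ∩ Ioi b, ENNReal.ofReal k * ENNReal.ofReal (1 / W (max a r)) ∂ν := by
        rw [Measure.restrict_restrict measurableSet_Ioi,
          lintegral_const_mul' _ _ ENNReal.ofReal_ne_top]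
    _ ≤ ∫⁻ r in Ioi 0 ∩ Ioi b, ENNReal.ofReal (q r) ∂ν :=
        setLIntegral_mono' (measurableSet_Ioi.inter measurableSet_Ioi)
          fun r ⟨(hr : 0 < r), (hbr : b < r)⟩ => by
            rw [← ENNReal.ofReal_mul hk, mul_one_div]
            have hle : W r ≤ W (max a r) := hW hr (lt_max_of_lt_right hr) (le_max_right a r)
            have hWr := hW0 r hr
            exact ENNReal.ofReal_le_ofReal <| (by gcongr : k / W (max a r) ≤ k / W r).trans <|
              hq r hr ((div_le_iff₀' (by positivity)).1 hbr.le)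
    _ ≤ ∫⁻ r in Ioi 0, ENNReal.ofReal (q r) ∂ν := lintegral_mono_set inter_subset_left

theorem meanInv_anti (hW : MonotoneOn W (Ioi 0)) (hW0 : ∀ r, 0 < r → 0 < W r) {b : ℝ}
    (hab : a ≤ b) : meanInv W b T ≤ meanInv W a T := by
  rw [meanInv_eq_lintegral_cond, meanInv_eq_lintegral_cond]
  exact setLIntegral_mono' measurableSet_Ioi fun r hr =>
    ENNReal.ofReal_le_ofReal <| antitoneOn_one_div hW hW0 (mem_Ioi.2 (lt_max_of_lt_right hr))
      (mem_Ioi.2 (lt_max_of_lt_right hr)) (max_le_max_right r hab)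

theorem ofReal_mul_integral_eq_setLAverage (hT : 0 ≤ T) (hg : IntervalIntegrable g volume 0 T)
    (hg0 : ∀ r ∈ Ioc 0 T, 0 ≤ g r) :
    ENNReal.ofReal (T⁻¹ * ∫ r in 0..T, g r) =
      ⨍⁻ r in Ioc 0 T, ENNReal.ofReal (g r) ∂volume := by
  have hnn : 0 ≤ᵐ[volume.restrict (Ioc 0 T)] g :=
    (ae_restrict_iff' measurableSet_Ioc).2 (.of_forall hg0)
  rw [setLAverage_eq, ← ofReal_setAverage hg.1 hnn, setAverage_eq, Real.volume_real_Ioc_of_le hT,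
    sub_zero, smul_eq_mul, intervalIntegral.integral_of_le hT]

theorem meanInv_le_ofReal (hT : 0 ≤ T) (hg : IntervalIntegrable g volume 0 T)
    (hg0 : ∀ r ∈ Ioc 0 T, 0 ≤ g r) (hWg : ∀ r ∈ Ioc 0 T, 1 / W (max a r) ≤ g r) :
    meanInv W a T ≤ ENNReal.ofReal (T⁻¹ * ∫ r in 0..T, g r) := by
  rw [ofReal_mul_integral_eq_setLAverage hT hg hg0, meanInv, setLAverage_eq, setLAverage_eq]
  gcongr ?_ / _
  exact setLIntegral_mono' measurableSet_Ioc fun r hr => ENNReal.ofReal_le_ofReal (hWg r hr)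

theorem ofReal_le_meanInv (hT : 0 ≤ T) (hg : IntervalIntegrable g volume 0 T)
    (hg0 : ∀ r ∈ Ioc 0 T, 0 ≤ g r) (hgW : ∀ r ∈ Ioc 0 T, g r ≤ 1 / W (max a r)) :
    ENNReal.ofReal (T⁻¹ * ∫ r in 0..T, g r) ≤ meanInv W a T := by
  rw [ofReal_mul_integral_eq_setLAverage hT hg hg0, meanInv, setLAverage_eq, setLAverage_eq]
  gcongr ?_ / _
  exact setLIntegral_mono' measurableSet_Ioc fun r hr => ENNReal.ofReal_le_ofReal (hgW r hr)

theorem ofReal_one_div_le_meanInv (hW : MonotoneOn W (Ioi 0)) (hW0 : ∀ r, 0 < r → 0 < W r)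
    (haT : a ≤ T) (hT : 0 < T) : ENNReal.ofReal (1 / W T) ≤ meanInv W a T := by
  have hWT := hW0 T hT
  calc ENNReal.ofReal (1 / W T) = ENNReal.ofReal (T⁻¹ * ∫ _ in 0..T, 1 / W T) := by
        rw [intervalIntegral.integral_const, sub_zero, smul_eq_mul, inv_mul_cancel_left₀ hT.ne']
    _ ≤ meanInv W a T :=
        ofReal_le_meanInv hT.le intervalIntegrable_const (fun _ _ => by positivity) fun r hr =>
          antitoneOn_one_div hW hW0 (lt_max_of_lt_right hr.1) hT (max_le haT hr.2)

theorem ofReal_div_le_meanInv (ha : 0 < a) (haT : a ≤ T) (hWa : 0 < W a) :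
    ENNReal.ofReal (a / T / W a) ≤ meanInv W a T := by
  have hT := ha.trans_le haT
  have hT0 : ENNReal.ofReal T ≠ 0 := (ENNReal.ofReal_pos.2 hT).ne'
  rw [meanInv, setLAverage_eq, Real.volume_Ioc, sub_zero,
    ENNReal.le_div_iff_mul_le (.inl hT0) (.inl ENNReal.ofReal_ne_top),
    ← ENNReal.ofReal_mul (by positivity)]
  calc ENNReal.ofReal (a / T / W a * T)
      = ∫⁻ _ in Ioc 0 a, ENNReal.ofReal (1 / W a) := by
        rw [setLIntegral_const, Real.volume_Ioc, sub_zero, ← ENNReal.ofReal_mul (by positivity)]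
        field_simp
    _ = ∫⁻ r in Ioc 0 a, ENNReal.ofReal (1 / W (max a r)) :=
        setLIntegral_congr_fun measurableSet_Ioc fun r hr => by simp only [max_eq_left hr.2]
    _ ≤ ∫⁻ r in Ioc 0 T, ENNReal.ofReal (1 / W (max a r)) :=
        lintegral_mono_set (Ioc_subset_Ioc_right haT)

theorem intervalIntegrable_comp_max (ha : 0 ≤ a) (haT : a ≤ T)
    (hg : IntervalIntegrable g volume a T) :
    IntervalIntegrable (fun r => g (max a r)) volume 0 T := by
  refine IntervalIntegrable.trans (b := a) ?_ ?_
  · refine (intervalIntegrable_const (c := g a)).congr fun r hr => ?_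
    rw [uIoc_of_le ha] at hr
    simp only [max_eq_left hr.2]
  · refine hg.congr fun r hr => ?_
    rw [uIoc_of_le haT] at hr
    simp only [max_eq_right hr.1.le]

theorem integral_comp_max (ha : 0 ≤ a) (haT : a ≤ T) (hg : IntervalIntegrable g volume a T) :
    ∫ r in 0..T, g (max a r) = a * g a + ∫ r in a..T, g r := by
  have hint := intervalIntegrable_comp_max ha haT hg
  have haT' : a ∈ uIcc 0 T := (uIcc_of_le (ha.trans haT)).symm ▸ ⟨ha, haT⟩
  have hleft : ∫ r in 0..a, g (max a r) = ∫ _ in 0..a, g a :=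
    intervalIntegral.integral_congr fun r hr => by
      rw [uIcc_of_le ha] at hr
      simp only [max_eq_left hr.2]
  have hright : ∫ r in a..T, g (max a r) = ∫ r in a..T, g r :=
    intervalIntegral.integral_congr fun r hr => by
      rw [uIcc_of_le haT] at hr
      simp only [max_eq_right hr.1]
  rw [← intervalIntegral.integral_add_adjacent_intervals
    (hint.mono_set (uIcc_subset_uIcc_left haT')) (hint.mono_set (uIcc_subset_uIcc_right haT')),
    hleft, hright, intervalIntegral.integral_const, sub_zero, smul_eq_mul]

theorem intervalIntegrable_inv_max (ha : 0 < a) (haT : a ≤ T) :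
    IntervalIntegrable (fun r => (max a r)⁻¹) volume 0 T :=
  intervalIntegrable_comp_max (g := fun r => r⁻¹) ha.le haT
    (intervalIntegrable_inv_iff.2 (.inr (notMem_uIcc_of_lt ha (ha.trans_le haT))))

theorem intervalIntegrable_max_rpow (ha : 0 < a) (haT : a ≤ T) (γ : ℝ) :
    IntervalIntegrable (fun r => max a r ^ γ) volume 0 T :=
  intervalIntegrable_comp_max (g := fun r => r ^ γ) ha.le haT
    (intervalIntegral.intervalIntegrable_rpow (.inr (notMem_uIcc_of_lt ha (ha.trans_le haT))))

theorem integral_inv_max (ha : 0 < a) (haT : a ≤ T) :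
    ∫ r in 0..T, (max a r)⁻¹ = 1 + Real.log (T / a) := by
  have hT : 0 < T := ha.trans_le haT
  rw [integral_comp_max (g := fun r => r⁻¹) ha.le haT
    (intervalIntegrable_inv_iff.2 (.inr (notMem_uIcc_of_lt ha hT))), mul_inv_cancel₀ ha.ne',
    integral_inv_of_pos ha hT]

theorem integral_max_rpow_le {γ : ℝ} (hγ : 1 < γ) (ha : 0 < a) (haT : a ≤ T) :
    ∫ r in 0..T, (max a r) ^ (-γ) ≤ a ^ (1 - γ) * (1 + (γ - 1)⁻¹) := by
  have h0 : (0 : ℝ) ∉ uIcc a T := notMem_uIcc_of_lt ha (ha.trans_le haT)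
  rw [integral_comp_max (g := fun r => r ^ (-γ)) ha.le haT
    (intervalIntegral.intervalIntegrable_rpow (.inr h0)), integral_rpow (.inr ⟨by linarith, h0⟩)]
  have haa : a * a ^ (-γ) = a ^ (1 - γ) := by
    rw [sub_eq_add_neg, Real.rpow_add ha, Real.rpow_one]
  have hT0 : 0 ≤ T ^ (1 - γ) := Real.rpow_nonneg (ha.le.trans haT) _
  have : 0 < γ - 1 := by linarith
  calc a * a ^ (-γ) + (T ^ (-γ + 1) - a ^ (-γ + 1)) / (-γ + 1)
      = a ^ (1 - γ) + (a ^ (1 - γ) - T ^ (1 - γ)) / (γ - 1) := by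
        rw [haa, neg_add_eq_sub, ← neg_div_neg_eq, neg_sub, neg_sub]
    _ ≤ a ^ (1 - γ) + a ^ (1 - γ) / (γ - 1) := by
        gcongr
        linarith
    _ = a ^ (1 - γ) * (1 + (γ - 1)⁻¹) := by rw [mul_add, mul_one, div_eq_mul_inv]

end Mean

section LaplaceTail

theorem mul_exp_neg_le_one_sub_exp_neg (x : ℝ) : x * Real.exp (-x) ≤ 1 - Real.exp (-x) := by
  have h : (x + 1) * Real.exp (-x) ≤ Real.exp x * Real.exp (-x) := by
    gcongr
    exact Real.add_one_le_exp x
  rw [← Real.exp_add, add_neg_cancel, Real.exp_zero] at h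
  linarith

theorem le_exp_one_mul_one_sub_exp_neg {x : ℝ} (hx0 : 0 ≤ x) (hx1 : x ≤ 1) :
    x ≤ Real.exp 1 * (1 - Real.exp (-x)) :=
  calc x ≤ Real.exp (1 - x) * x := le_mul_of_one_le_left hx0 (Real.one_le_exp (by linarith))
    _ = Real.exp 1 * (x * Real.exp (-x)) := by rw [sub_eq_add_neg, Real.exp_add]; ring
    _ ≤ Real.exp 1 * (1 - Real.exp (-x)) := by
      gcongr
      exact mul_exp_neg_le_one_sub_exp_neg x

variable {Ω : Type*} [MeasurableSpace Ω] {P : Measure Ω} [IsProbabilityMeasure P] {Y : Ω → ℝ}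
  {t ε : ℝ}

theorem integrable_exp_neg_mul (hY : Measurable Y) (hY0 : 0 ≤ᵐ[P] Y) {l : ℝ} (hl : 0 ≤ l) :
    Integrable (fun ω => Real.exp (-l * Y ω)) P := by
  refine Integrable.of_bound (C := 1) (hY.const_mul (-l)).exp.aestronglyMeasurable ?_
  filter_upwards [hY0] with ω (hω : 0 ≤ Y ω)
  rw [Real.norm_eq_abs, Real.abs_exp, Real.exp_le_one_iff, neg_mul, neg_nonpos]
  positivity

theorem integral_one_sub_exp_neg_mul (hY : Measurable Y) (hY0 : 0 ≤ᵐ[P] Y) {l : ℝ} (hl : 0 ≤ l) :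
    ∫ ω, (1 - Real.exp (-l * Y ω)) ∂P = 1 - mgf Y P (-l) := by
  rw [integral_sub (integrable_const _) (integrable_exp_neg_mul hY hY0 hl), integral_const,
    probReal_univ, one_smul, mgf]

theorem mul_measureReal_ge_le_one_sub_mgf (hY : Measurable Y) (hY0 : 0 ≤ᵐ[P] Y) (ht : 0 < t) :
    (1 - Real.exp (-1)) * P.real {ω | t ≤ Y ω} ≤ 1 - mgf Y P (-t⁻¹) := by
  have hl : 0 ≤ t⁻¹ := by positivity
  have hsub : {ω | t ≤ Y ω} ⊆ {ω | 1 - Real.exp (-1) ≤ 1 - Real.exp (-t⁻¹ * Y ω)} :=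
    fun ω (hω : t ≤ Y ω) => sub_le_sub_left (Real.exp_le_exp.2 <| by
      rw [neg_mul, neg_le_neg_iff, inv_mul_eq_div, one_le_div ht]
      exact hω) _
  have hnonneg : 0 ≤ᵐ[P] fun ω => 1 - Real.exp (-t⁻¹ * Y ω) := by
    filter_upwards [hY0] with ω (hω : 0 ≤ Y ω)
    rw [Pi.zero_apply, sub_nonneg, Real.exp_le_one_iff, neg_mul, neg_nonpos]
    positivity
  calc (1 - Real.exp (-1)) * P.real {ω | t ≤ Y ω}
      ≤ (1 - Real.exp (-1)) * P.real {ω | 1 - Real.exp (-1) ≤ 1 - Real.exp (-t⁻¹ * Y ω)} := by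
        gcongr
        · exact sub_nonneg.2 (Real.exp_le_one_iff.2 (by norm_num))
        · exact measure_ne_top _ _
    _ ≤ ∫ ω, (1 - Real.exp (-t⁻¹ * Y ω)) ∂P :=
        mul_meas_ge_le_integral_of_nonneg hnonneg
          ((integrable_const _).sub (integrable_exp_neg_mul hY hY0 hl)) _
    _ = 1 - mgf Y P (-t⁻¹) := integral_one_sub_exp_neg_mul hY hY0 hl

theorem one_sub_exp_neg_le_indicator_add (ht : 0 < t) (hε : 0 ≤ ε) {y : ℝ} (hy : 0 ≤ y) :
    1 - Real.exp (-(ε / t) * y) ≤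
      (Ici t).indicator 1 y + ε * Real.exp 1 * (1 - Real.exp (-t⁻¹ * y)) := by
  rcases le_or_gt t y with hty | hty
  · have hexp : 0 ≤ 1 - Real.exp (-t⁻¹ * y) := by
      rw [sub_nonneg, Real.exp_le_one_iff, neg_mul, neg_nonpos]
      positivity
    have hrest : 0 ≤ ε * Real.exp 1 * (1 - Real.exp (-t⁻¹ * y)) := by positivity
    rw [indicator_of_mem (mem_Ici.2 hty), Pi.one_apply]
    linarith [Real.exp_pos (-(ε / t) * y)]
  · have hle : y / t ≤ 1 := (div_le_one ht).2 hty.le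
    rw [indicator_of_notMem (notMem_Ici.2 hty), zero_add]
    calc 1 - Real.exp (-(ε / t) * y) ≤ ε * (y / t) := by
          linarith [Real.add_one_le_exp (-(ε / t) * y), (by ring : -(ε / t) * y = -(ε * (y / t)))]
      _ ≤ ε * (Real.exp 1 * (1 - Real.exp (-(y / t)))) := by
          gcongr
          exact le_exp_one_mul_one_sub_exp_neg (by positivity) hle
      _ = ε * Real.exp 1 * (1 - Real.exp (-t⁻¹ * y)) := by
          rw [neg_mul, inv_mul_eq_div, mul_assoc]

theorem one_sub_mgf_le_measureReal_ge_add (hY : Measurable Y) (hY0 : 0 ≤ᵐ[P] Y) (ht : 0 < t)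
    (hε : 0 ≤ ε) : 1 - mgf Y P (-(ε / t)) ≤
      P.real {ω | t ≤ Y ω} + ε * Real.exp 1 * (1 - mgf Y P (-t⁻¹)) := by
  have hl : 0 ≤ t⁻¹ := by positivity
  have hl' : 0 ≤ ε / t := by positivity
  have hset : MeasurableSet (Y ⁻¹' Ici t) := hY measurableSet_Ici
  have hind : Integrable ((Y ⁻¹' Ici t).indicator (1 : Ω → ℝ)) P :=
    (integrable_const _).indicator hset
  have hexp : Integrable (fun ω => ε * Real.exp 1 * (1 - Real.exp (-t⁻¹ * Y ω))) P :=
    ((integrable_const _).sub (integrable_exp_neg_mul hY hY0 hl)).const_mul _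
  calc 1 - mgf Y P (-(ε / t)) = ∫ ω, (1 - Real.exp (-(ε / t) * Y ω)) ∂P :=
        (integral_one_sub_exp_neg_mul hY hY0 hl').symm
    _ ≤ ∫ ω, ((Y ⁻¹' Ici t).indicator (1 : Ω → ℝ) ω +
          ε * Real.exp 1 * (1 - Real.exp (-t⁻¹ * Y ω))) ∂P :=
        integral_mono_ae ((integrable_const _).sub (integrable_exp_neg_mul hY hY0 hl'))
          (hind.add hexp) (hY0.mono fun ω hω => one_sub_exp_neg_le_indicator_add ht hε hω)
    _ = P.real {ω | t ≤ Y ω} + ε * Real.exp 1 * (1 - mgf Y P (-t⁻¹)) := by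
        rw [integral_add hind hexp, integral_indicator_one hset, integral_const_mul,
          integral_one_sub_exp_neg_mul hY hY0 hl]
        rfl

end LaplaceTail

section Stieltjes

theorem rightLim_mem_Icc {f g h : ℝ → ℝ} (hf : Monotone f) (hg : Continuous g) (hh : Continuous h)
    {r : ℝ} (hfgh : ∀ s, r < s → f s ∈ Icc (g s) (h s)) :
    Function.rightLim f r ∈ Icc (g r) (h r) :=
  ⟨le_of_tendsto_of_tendsto (hg.tendsto r |>.mono_left nhdsWithin_le_nhds) (hf.tendsto_rightLim r)
      (eventually_mem_nhdsWithin.mono fun s hs => (hfgh s hs).1),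
    le_of_tendsto_of_tendsto (hf.tendsto_rightLim r) (hh.tendsto r |>.mono_left nhdsWithin_le_nhds)
      (eventually_mem_nhdsWithin.mono fun s hs => (hfgh s hs).2)⟩

theorem stieltjesFunction_measure_Ioc_zero_mem_Icc {f g h : ℝ → ℝ} (hf : Monotone f)
    (hg : Continuous g) (hh : Continuous h) (hg0 : g 0 = 0) (hh0 : h 0 = 0)
    (hfgh : ∀ s, 0 < s → f s ∈ Icc (g s) (h s)) {r : ℝ} (hr : 0 ≤ r) :
    hf.stieltjesFunction.measure (Ioc 0 r) ∈ Icc (ENNReal.ofReal (g r)) (ENNReal.ofReal (h r)) := by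
  have h0 : Function.rightLim f 0 = 0 := by
    have := rightLim_mem_Icc hf hg hh hfgh
    rwa [hg0, hh0, Icc_self] at this
  have hlim := rightLim_mem_Icc hf hg hh fun s hs => hfgh s (hr.trans_lt hs)
  rw [StieltjesFunction.measure_Ioc, hf.stieltjesFunction_eq, hf.stieltjesFunction_eq, h0, sub_zero]
  exact ⟨ENNReal.ofReal_le_ofReal hlim.1, ENNReal.ofReal_le_ofReal hlim.2⟩

end Stieltjes

theorem exists_mul_le_rpow {β : ℝ} (hβ : β < 1) (K : ℝ) :
    ∃ ε : ℝ, 0 < ε ∧ ε ≤ 1 ∧ K * ε ≤ ε ^ β := by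
  have hlim : Filter.Tendsto (fun ε : ℝ => K * ε ^ (1 - β)) (nhdsWithin 0 (Ioi 0)) (nhds 0) := by
    have h := (Real.continuousAt_rpow_const 0 (1 - β) (.inr (by linarith))).tendsto.const_mul K
    rw [Real.zero_rpow (by linarith), mul_zero] at h
    exact h.mono_left nhdsWithin_le_nhds
  obtain ⟨ε, hKε, hε⟩ :=
    ((hlim.eventually_le_const one_pos).and (Ioc_mem_nhdsGT (one_pos : (0 : ℝ) < 1))).exists
  refine ⟨ε, hε.1, hε.2, ?_⟩
  calc K * ε = K * ε ^ (1 - β) * ε ^ β := by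
        rw [mul_assoc, ← Real.rpow_add hε.1, sub_add_cancel, Real.rpow_one]
    _ ≤ ε ^ β := mul_le_of_le_one_left (Real.rpow_nonneg hε.1.le β) hKε

section Subordinator

/-- `φ` is the Laplace exponent of `S`, `E exp(-l S_t) = exp(-t φ(l))`, whether or not `S` has a
drift. -/
def IsLaplaceExponent {Ω : Type*} [MeasurableSpace Ω] (P : Measure Ω) (S : ℝ≥0 → Ω → ℝ)
    (φ : ℝ → ℝ) : Prop :=
  ∀ (t : ℝ≥0) (l : ℝ), 0 < t → 0 < l → mgf (S t) P (-l) = Real.exp (-(t : ℝ) * φ l)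

variable {Ω : Type*} [MeasurableSpace Ω] {P : Measure Ω} {S : ℝ≥0 → Ω → ℝ} {φ : ℝ → ℝ}
  {β₁ β₂ : ℝ}

theorem IsSubordinator.nonneg_ae (hS : IsSubordinator P S) (r : ℝ≥0) : 0 ≤ᵐ[P] S r := by
  filter_upwards [hS.zero, hS.mono] with ω h0 hmono
  exact h0.symm.le.trans (hmono zero_le)

theorem IsLaplaceExponent.one_sub_mgf (hφ : IsLaplaceExponent P S φ) {r l : ℝ} (hr : 0 < r)
    (hl : 0 < l) : 1 - mgf (S r.toNNReal) P (-l) = 1 - Real.exp (-(r * φ l)) := by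
  rw [hφ _ _ (Real.toNNReal_pos.2 hr) hl, Real.coe_toNNReal r hr.le, neg_mul]

variable [IsProbabilityMeasure P]

theorem IsLaplaceExponent.tail_le (hφ : IsLaplaceExponent P S φ) (hS : IsSubordinator P S)
    {t r : ℝ} (ht : 0 < t) (hr : 0 < r) :
    tail P S t r ≤ (1 - Real.exp (-1))⁻¹ * min (r * φ t⁻¹) 1 := by
  have he : 0 < 1 - Real.exp (-1) := sub_pos.2 (Real.exp_lt_one_iff.2 (by norm_num))
  have hmarkov : (1 - Real.exp (-1)) * tail P S t r ≤ 1 - Real.exp (-(r * φ t⁻¹)) :=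
    (mul_measureReal_ge_le_one_sub_mgf (hS.measurable _) (hS.nonneg_ae _) ht).trans_eq
      (hφ.one_sub_mgf hr (inv_pos.2 ht))
  rw [inv_mul_eq_div, le_div_iff₀' he]
  refine hmarkov.trans (le_min ?_ ?_)
  · linarith [Real.add_one_le_exp (-(r * φ t⁻¹))]
  · linarith [Real.exp_pos (-(r * φ t⁻¹))]

theorem WeakScaling.exists_mul_le_apply_div (hφs : WeakScaling φ β₁ β₂) (hβ₂ : β₂ < 1) (K : ℝ) :
    ∃ ε : ℝ, 0 < ε ∧ ∀ t, 0 < t → K * ε * φ t⁻¹ ≤ φ (ε / t) ∧ φ (ε / t) ≤ φ t⁻¹ := by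
  obtain ⟨_, c₂, _, hc₂, hsc⟩ := hφs.scaling
  obtain ⟨ε, hε, hε1, hKε⟩ := exists_mul_le_rpow hβ₂ (K * c₂)
  refine ⟨ε, hε, fun t ht => ?_⟩
  have hlt : 0 < ε / t := by positivity
  have hle : ε / t ≤ t⁻¹ := by rw [div_eq_mul_inv]; exact mul_le_of_le_one_left (by positivity) hε1
  have hφε : 0 < φ (ε / t) := hφs.pos () _ hlt
  have hφt : 0 < φ t⁻¹ := hφs.pos () _ (inv_pos.2 ht)
  refine ⟨?_, hφs.mono () hlt (hlt.trans_le hle) hle⟩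
  have hratio : φ t⁻¹ ≤ c₂ * (ε ^ β₂)⁻¹ * φ (ε / t) := by
    have h := (hsc () _ _ hlt hle).2
    rwa [show t⁻¹ / (ε / t) = ε⁻¹ by field_simp, Real.inv_rpow hε.le, div_le_iff₀ hφε] at h
  rw [← div_eq_mul_inv, div_mul_eq_mul_div, le_div_iff₀ (by positivity)] at hratio
  refine le_of_mul_le_mul_left ?_ hc₂
  calc c₂ * (K * ε * φ t⁻¹) = φ t⁻¹ * (K * c₂ * ε) := by ring
    _ ≤ φ t⁻¹ * ε ^ β₂ := by gcongr
    _ ≤ c₂ * φ (ε / t) := hratio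

theorem IsLaplaceExponent.exists_mul_le_tail_of_mul_le_one (hφ : IsLaplaceExponent P S φ)
    (hS : IsSubordinator P S) (hφs : WeakScaling φ β₁ β₂) (hβ₂ : β₂ < 1) :
    ∃ c : ℝ, 0 < c ∧ ∀ t r : ℝ, 0 < t → 0 < r → r * φ t⁻¹ ≤ 1 → c * (r * φ t⁻¹) ≤ tail P S t r := by
  obtain ⟨ε, hε, hεφ⟩ := hφs.exists_mul_le_apply_div hβ₂ (2 * Real.exp 1 ^ 2)
  refine ⟨Real.exp 1 * ε, by positivity, fun t r ht hr hrφ => ?_⟩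
  obtain ⟨hKφ, hmono⟩ := hεφ t ht
  have hεt : 0 < ε / t := by positivity
  have hφε := hφs.pos () _ hεt
  have htail : 1 - Real.exp (-(r * φ (ε / t))) ≤
      tail P S t r + ε * Real.exp 1 * (1 - Real.exp (-(r * φ t⁻¹))) := by
    rw [← hφ.one_sub_mgf hr hεt, ← hφ.one_sub_mgf hr (inv_pos.2 ht)]
    exact one_sub_mgf_le_measureReal_ge_add (hS.measurable _) (hS.nonneg_ae _) ht hε.le
  have hmain : 2 * Real.exp 1 * ε * (r * φ t⁻¹) ≤ 1 - Real.exp (-(r * φ (ε / t))) := by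
    refine le_of_mul_le_mul_left ?_ (Real.exp_pos 1)
    calc Real.exp 1 * (2 * Real.exp 1 * ε * (r * φ t⁻¹))
        = r * (2 * Real.exp 1 ^ 2 * ε * φ t⁻¹) := by ring
      _ ≤ r * φ (ε / t) := by gcongr
      _ ≤ Real.exp 1 * (1 - Real.exp (-(r * φ (ε / t)))) :=
        le_exp_one_mul_one_sub_exp_neg (by positivity)
          ((mul_le_mul_of_nonneg_left hmono hr.le).trans hrφ)
  have hrest : ε * Real.exp 1 * (1 - Real.exp (-(r * φ t⁻¹))) ≤ ε * Real.exp 1 * (r * φ t⁻¹) := by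
    gcongr
    linarith [Real.add_one_le_exp (-(r * φ t⁻¹))]
  linarith

theorem IsLaplaceExponent.exists_mul_le_tail (hφ : IsLaplaceExponent P S φ)
    (hS : IsSubordinator P S) (hφs : WeakScaling φ β₁ β₂) (hβ₂ : β₂ < 1) :
    ∃ c : ℝ, 0 < c ∧ ∀ t r : ℝ, 0 < t → 0 < r → c * min (r * φ t⁻¹) 1 ≤ tail P S t r := by
  obtain ⟨c, hc, hsmall⟩ := hφ.exists_mul_le_tail_of_mul_le_one hS hφs hβ₂
  refine ⟨c, hc, fun t r ht hr => ?_⟩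
  have hφt := hφs.pos () _ (inv_pos.2 ht)
  have hmin : min r (φ t⁻¹)⁻¹ * φ t⁻¹ = min (r * φ t⁻¹) 1 := by
    rw [min_mul_of_nonneg _ _ hφt.le, inv_mul_cancel₀ hφt.ne']
  rw [← hmin]
  exact (hsmall t _ ht (lt_min hr (inv_pos.2 hφt)) (hmin.trans_le (min_le_right _ _))).trans
    (hS.monotone_tail t (min_le_left _ _))

theorem IsLaplaceExponent.exists_stieltjes_measure_Ioc_mem_Icc (hφ : IsLaplaceExponent P S φ)
    (hS : IsSubordinator P S) (hφs : WeakScaling φ β₁ β₂) (hβ₂ : β₂ < 1) :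
    ∃ c C : ℝ, 0 < c ∧ 0 < C ∧ ∀ t r : ℝ, 0 < t → 0 ≤ r →
      (hS.monotone_tail t).stieltjesFunction.measure (Ioc 0 r) ∈
        Icc (ENNReal.ofReal (c * min (r * φ t⁻¹) 1)) (ENNReal.ofReal (C * min (r * φ t⁻¹) 1)) := by
  obtain ⟨c, hc, hle⟩ := hφ.exists_mul_le_tail hS hφs hβ₂
  refine ⟨c, (1 - Real.exp (-1))⁻¹, hc,
    inv_pos.2 (sub_pos.2 (Real.exp_lt_one_iff.2 (by norm_num))), fun t r ht hr => ?_⟩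
  exact stieltjesFunction_measure_Ioc_zero_mem_Icc (g := fun r => c * min (r * φ t⁻¹) 1)
    (h := fun r => (1 - Real.exp (-1))⁻¹ * min (r * φ t⁻¹) 1) (hS.monotone_tail t)
    (by fun_prop) (by fun_prop) (by simp) (by simp)
    (fun s hs => ⟨hle t s ht hs, hφ.tail_le hS ht hs⟩) hr

end Subordinator

section Scaling

open Filter Topology

variable {Λ : Type*} {Ψ : Λ → ℝ → ℝ} {Φ : ℝ → ℝ} {a₁ a₂ α₁ α₂ : ℝ}

theorem WeakScalingUniformly.pos_right (h : WeakScalingUniformly Ψ a₁ a₂) : 0 < a₂ :=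
  h.pos_left.trans_le h.left_le_right

theorem WeakScalingUniformly.exists_mul_le_and_le_mul (h : WeakScalingUniformly Ψ a₁ a₂) :
    ∃ c₁ c₂ : ℝ, 0 < c₁ ∧ 0 < c₂ ∧ ∀ x r R, 0 < r → r ≤ R →
      c₁ * (R / r) ^ a₁ * Ψ x r ≤ Ψ x R ∧ Ψ x R ≤ c₂ * (R / r) ^ a₂ * Ψ x r := by
  obtain ⟨c₁, c₂, hc₁, hc₂, hsc⟩ := h.scaling
  refine ⟨c₁, c₂, hc₁, hc₂, fun x r R hr hrR => ?_⟩
  obtain ⟨hlower, hupper⟩ := hsc x r R hr hrR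
  exact ⟨(le_div_iff₀ (h.pos x r hr)).1 hlower, (div_le_iff₀ (h.pos x r hr)).1 hupper⟩

theorem WeakScaling.apply_pos (h : WeakScaling Φ α₁ α₂) {r : ℝ} (hr : 0 < r) : 0 < Φ r :=
  h.pos () r hr

theorem WeakScaling.apply_nonneg (h : WeakScaling Φ α₁ α₂) (h0 : Φ 0 = 0) {r : ℝ} (hr : 0 ≤ r) :
    0 ≤ Φ r := by
  rcases hr.eq_or_lt with rfl | hr
  exacts [h0.ge, (h.apply_pos hr).le]

theorem WeakScaling.apply_le_apply (h : WeakScaling Φ α₁ α₂) {r R : ℝ} (hr : 0 < r) (hrR : r ≤ R) :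
    Φ r ≤ Φ R :=
  h.mono () hr (hr.trans_le hrR) hrR

theorem WeakScaling.tendsto_atTop (h : WeakScaling Φ α₁ α₂) : Tendsto Φ atTop atTop := by
  obtain ⟨c₁, _, hc₁, _, hsc⟩ := h.exists_mul_le_and_le_mul
  have hΦ1 := h.apply_pos one_pos
  have hlower : ∀ᶠ R in atTop, c₁ * Φ 1 * R ^ α₁ ≤ Φ R := by
    filter_upwards [eventually_ge_atTop 1] with R hR
    calc c₁ * Φ 1 * R ^ α₁ = c₁ * (R / 1) ^ α₁ * Φ 1 := by rw [div_one]; ring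
      _ ≤ Φ R := (hsc () 1 R one_pos hR).1
  exact tendsto_atTop_mono' _ hlower
    ((tendsto_rpow_atTop h.pos_left).const_mul_atTop (by positivity))

theorem WeakScaling.tendsto_nhdsGT_zero (h : WeakScaling Φ α₁ α₂) :
    Tendsto Φ (𝓝[>] 0) (𝓝 0) := by
  obtain ⟨c₁, _, hc₁, _, hsc⟩ := h.exists_mul_le_and_le_mul
  have hupper : ∀ r ∈ Ioc (0 : ℝ) 1, Φ r ≤ Φ 1 / c₁ * r ^ α₁ := fun r hr => by
    have hle := (hsc () r 1 hr.1 hr.2).1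
    have hrα := Real.rpow_pos_of_pos hr.1 α₁
    rw [one_div, Real.inv_rpow hr.1.le, mul_right_comm, ← div_eq_mul_inv, div_le_iff₀ hrα] at hle
    rw [div_mul_eq_mul_div, le_div_iff₀' hc₁]
    exact hle
  have hlim : Tendsto (fun r : ℝ => Φ 1 / c₁ * r ^ α₁) (𝓝[>] 0) (𝓝 0) := by
    have hcont := (Real.continuousAt_rpow_const 0 α₁ (.inr h.pos_left.le)).tendsto.const_mul
      (Φ 1 / c₁)
    rw [Real.zero_rpow h.pos_left.ne', mul_zero] at hcont
    exact hcont.mono_left nhdsWithin_le_nhds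
  refine tendsto_of_tendsto_of_tendsto_of_le_of_le' tendsto_const_nhds hlim ?_ ?_
  · exact eventually_mem_nhdsWithin.mono fun r hr => (h.apply_pos hr).le
  · exact eventually_of_mem (Ioc_mem_nhdsGT one_pos) hupper

theorem bddBelow_inv_set (Φ : ℝ → ℝ) (s : ℝ) : BddBelow {r : ℝ | 0 ≤ r ∧ s ≤ Φ r} :=
  ⟨0, fun _ hr => hr.1⟩

theorem inv_apply (hΦ : StrictMonoOn Φ (Ici 0)) {r : ℝ} (hr : 0 ≤ r) : inv Φ (Φ r) = r :=
  le_antisymm (csInf_le (bddBelow_inv_set Φ _) ⟨hr, le_rfl⟩)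
    (le_csInf ⟨r, hr, le_rfl⟩ fun _ hu => (hΦ.le_iff_le hr hu.1).1 hu.2)

theorem apply_lt_of_lt_inv {r s : ℝ} (hr : 0 ≤ r) (hrs : r < inv Φ s) : Φ r < s :=
  not_le.1 fun hs => hrs.not_ge (csInf_le (bddBelow_inv_set Φ s) ⟨hr, hs⟩)

theorem WeakScaling.inv_set_nonempty (h : WeakScaling Φ α₁ α₂) (s : ℝ) :
    {r : ℝ | 0 ≤ r ∧ s ≤ Φ r}.Nonempty :=
  ((eventually_ge_atTop 0).and (h.tendsto_atTop.eventually_ge_atTop s)).exists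

theorem WeakScaling.inv_apply_pos (h : WeakScaling Φ α₁ α₂) (h0 : Φ 0 = 0) {s : ℝ} (hs : 0 < s) :
    0 < inv Φ s := by
  obtain ⟨r, hrs, hr⟩ :=
    ((h.tendsto_nhdsGT_zero.eventually_lt_const hs).and self_mem_nhdsWithin).exists
  refine (mem_Ioi.1 hr).trans_le (le_csInf (h.inv_set_nonempty s) fun u hu => ?_)
  by_contra! hur
  rcases hu.1.eq_or_lt with rfl | hu0
  · exact hs.not_ge (h0 ▸ hu.2)
  · exact hrs.not_ge (hu.2.trans (h.apply_le_apply hu0 hur.le))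

theorem WeakScaling.monotone_inv (h : WeakScaling Φ α₁ α₂) : Monotone (inv Φ) := fun s _ hst =>
  csInf_le_csInf (bddBelow_inv_set Φ s) (h.inv_set_nonempty _) fun _ hr => ⟨hr.1, hst.trans hr.2⟩

theorem WeakScaling.apply_le_of_inv_lt (h : WeakScaling Φ α₁ α₂) (h0 : Φ 0 = 0) {r s : ℝ}
    (hs : 0 < s) (hrs : inv Φ s < r) : s ≤ Φ r := by
  obtain ⟨u, hu, hur⟩ := exists_lt_of_csInf_lt (h.inv_set_nonempty s) hrs
  exact hu.2.trans (h.apply_le_apply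
    ((h.inv_apply_pos h0 hs).trans_le (csInf_le (bddBelow_inv_set Φ s) hu)) hur.le)

-- `Φ` may jump, so that `Φ ∘ Φ⁻¹` is the identity only up to constants.
theorem WeakScaling.exists_apply_inv_mem_Icc (h : WeakScaling Φ α₁ α₂) (h0 : Φ 0 = 0) :
    ∃ c C : ℝ, 0 < c ∧ 0 < C ∧ ∀ s, 0 < s → Φ (inv Φ s) ∈ Icc (c * s) (C * s) := by
  obtain ⟨_, c₂, _, hc₂, hsc⟩ := h.exists_mul_le_and_le_mul
  have hK : 0 < c₂ * 2 ^ α₂ := by positivity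
  refine ⟨(c₂ * 2 ^ α₂)⁻¹, c₂ * 2 ^ α₂, by positivity, hK, fun s hs => ?_⟩
  have hi := h.inv_apply_pos h0 hs
  constructor
  · rw [inv_mul_le_iff₀ hK]
    calc s ≤ Φ (2 * inv Φ s) := h.apply_le_of_inv_lt h0 hs (by linarith)
      _ ≤ c₂ * (2 * inv Φ s / inv Φ s) ^ α₂ * Φ (inv Φ s) := (hsc () _ _ hi (by linarith)).2
      _ = c₂ * 2 ^ α₂ * Φ (inv Φ s) := by rw [mul_div_cancel_right₀ _ hi.ne']
  · have hhalf : 0 < inv Φ s / 2 := by positivity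
    calc Φ (inv Φ s) ≤ c₂ * (inv Φ s / (inv Φ s / 2)) ^ α₂ * Φ (inv Φ s / 2) :=
          (hsc () _ _ hhalf (by linarith)).2
      _ = c₂ * 2 ^ α₂ * Φ (inv Φ s / 2) := by rw [div_div_cancel₀ hi.ne']
      _ ≤ c₂ * 2 ^ α₂ * s := by
        gcongr
        exact (apply_lt_of_lt_inv hhalf.le (by linarith)).le

theorem WeakScaling.weakScaling_inv (h : WeakScaling Φ α₁ α₂) (h0 : Φ 0 = 0) :
    WeakScaling (inv Φ) α₂⁻¹ α₁⁻¹ := by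
  have hα₁ : 0 < α₁ := h.pos_left
  have hα₂ : 0 < α₂ := h.pos_right
  obtain ⟨c, C, hc, hC, hcC⟩ := h.exists_apply_inv_mem_Icc h0
  obtain ⟨c₁, c₂, hc₁, hc₂, hsc⟩ := h.scaling
  refine ⟨by positivity, inv_anti₀ hα₁ h.left_le_right, fun _ r hr => h.inv_apply_pos h0 hr,
    fun _ => h.monotone_inv.monotoneOn _, (c / C / c₂) ^ α₂⁻¹, (C / c / c₁) ^ α₁⁻¹,
    by positivity, by positivity, fun _ r R hr hrR => ?_⟩
  have hR : 0 < R := hr.trans_le hrR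
  have hir := h.inv_apply_pos h0 hr
  have hiR := h.inv_apply_pos h0 hR
  have hΦr := h.apply_pos hir
  have hΦR := h.apply_pos hiR
  have hratio : 0 < inv Φ R / inv Φ r := by positivity
  obtain ⟨hlower, hupper⟩ := hsc () _ _ hir (h.monotone_inv hrR)
  obtain ⟨hr₁, hr₂⟩ := hcC r hr
  obtain ⟨hR₁, hR₂⟩ := hcC R hR
  constructor
  · rw [← Real.mul_rpow (by positivity) (by positivity),
      Real.rpow_inv_le_iff_of_pos (by positivity) hratio.le hα₂, div_mul_eq_mul_div,
      div_le_iff₀' hc₂]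
    calc c / C * (R / r) = c * R / (C * r) := by field_simp
      _ ≤ Φ (inv Φ R) / Φ (inv Φ r) := by gcongr
      _ ≤ c₂ * (inv Φ R / inv Φ r) ^ α₂ := hupper
  · rw [← Real.mul_rpow (by positivity) (by positivity),
      Real.le_rpow_inv_iff_of_pos hratio.le (by positivity) hα₁, div_mul_eq_mul_div,
      le_div_iff₀' hc₁]
    calc c₁ * (inv Φ R / inv Φ r) ^ α₁ ≤ Φ (inv Φ R) / Φ (inv Φ r) := hlower
      _ ≤ C * R / (c * r) := by gcongr
      _ = C / c * (R / r) := by field_simp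

theorem WeakScalingUniformly.comp (hΨ : WeakScalingUniformly Ψ a₁ a₂) (h : WeakScaling Φ α₁ α₂) :
    WeakScalingUniformly (fun x r => Ψ x (Φ r)) (α₁ * a₁) (α₂ * a₂) := by
  have hα₁ : 0 < α₁ := h.pos_left
  have hα₂ : 0 < α₂ := h.pos_right
  have ha₁ : 0 < a₁ := hΨ.pos_left
  have ha₂ : 0 < a₂ := hΨ.pos_right
  obtain ⟨c₁, c₂, hc₁, hc₂, hΦsc⟩ := h.scaling
  obtain ⟨b₁, b₂, hb₁, hb₂, hΨsc⟩ := hΨ.scaling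
  refine ⟨by positivity, mul_le_mul h.left_le_right hΨ.left_le_right ha₁.le hα₂.le,
    fun x r hr => hΨ.pos _ _ (h.apply_pos hr),
    fun x r hr R hR hrR => hΨ.mono x (h.apply_pos hr) (h.apply_pos hR) (h.apply_le_apply hr hrR),
    b₁ * c₁ ^ a₁, b₂ * c₂ ^ a₂, by positivity, by positivity, fun x r R hr hrR => ?_⟩
  have hR : 0 < R := hr.trans_le hrR
  obtain ⟨hΦ₁, hΦ₂⟩ := hΦsc () r R hr hrR
  obtain ⟨hΨ₁, hΨ₂⟩ := hΨsc x _ _ (h.apply_pos hr) (h.apply_le_apply hr hrR)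
  have hΦr := h.apply_pos hr
  have hΦR := h.apply_pos hR
  constructor
  · refine le_trans ?_ hΨ₁
    rw [mul_assoc, Real.rpow_mul (by positivity), ← Real.mul_rpow (by positivity) (by positivity)]
    gcongr
  · refine hΨ₂.trans ?_
    rw [mul_assoc, Real.rpow_mul (by positivity), ← Real.mul_rpow (by positivity) (by positivity)]
    gcongr

end Scaling

section Regimes

variable {Λ : Type*} {W : Λ → ℝ → ℝ} {γ₁ γ₂ : ℝ}

theorem WeakScalingUniformly.exists_meanInv_bounds_of_right_lt_one
    (hW : WeakScalingUniformly W γ₁ γ₂) (hγ₂ : γ₂ < 1) :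
    ∃ c C : ℝ, 0 < c ∧ 0 < C ∧ ∀ x a T, 0 ≤ a → a ≤ T → 0 < T →
      ENNReal.ofReal (c * (1 / W x T)) ≤ meanInv (W x) a T ∧
        meanInv (W x) a T ≤ ENNReal.ofReal (C * (1 / W x T)) := by
  obtain ⟨_, b, _, hb, hsc⟩ := hW.exists_mul_le_and_le_mul
  have hγ : 0 < 1 - γ₂ := by linarith
  refine ⟨1, b * (1 - γ₂)⁻¹, one_pos, by positivity, fun x a T ha haT hT => ?_⟩
  have hWT := hW.pos x T hT
  have hint : IntervalIntegrable (fun r : ℝ => b * T ^ γ₂ / W x T * r ^ (-γ₂)) volume 0 T :=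
    (intervalIntegral.intervalIntegrable_rpow' (by linarith)).const_mul _
  have hle : ∀ r ∈ Ioc 0 T, 1 / W x (max 0 r) ≤ b * T ^ γ₂ / W x T * r ^ (-γ₂) := fun r hr => by
    have hr0 : 0 < r := hr.1
    have hscale := (hsc x r T hr0 hr.2).2
    rw [Real.div_rpow hT.le hr0.le] at hscale
    rw [max_eq_right hr0.le, div_le_iff₀ (hW.pos x r hr0), Real.rpow_neg hr0.le,
      div_mul_eq_mul_div, div_mul_eq_mul_div, one_le_div hWT]
    exact hscale.trans_eq (by ring)
  refine ⟨(one_mul (1 / W x T)).symm ▸ ofReal_one_div_le_meanInv (hW.mono x) (hW.pos x) haT hT, ?_⟩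
  calc meanInv (W x) a T ≤ meanInv (W x) 0 T := meanInv_anti (hW.mono x) (hW.pos x) ha
    _ ≤ ENNReal.ofReal (T⁻¹ * ∫ r in 0..T, b * T ^ γ₂ / W x T * r ^ (-γ₂)) :=
        meanInv_le_ofReal hT.le hint (fun r hr => by have := hr.1; positivity) hle
    _ = ENNReal.ofReal (b * (1 - γ₂)⁻¹ * (1 / W x T)) := by
        rw [intervalIntegral.integral_const_mul, integral_rpow (.inl (by linarith)),
          neg_add_eq_sub, Real.zero_rpow hγ.ne', sub_zero, Real.rpow_sub hT, Real.rpow_one]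
        field_simp

theorem WeakScalingUniformly.exists_meanInv_bounds_of_one_lt_left
    (hW : WeakScalingUniformly W γ₁ γ₂) (hγ₁ : 1 < γ₁) :
    ∃ c C : ℝ, 0 < c ∧ 0 < C ∧ ∀ x a T, 0 < a → a ≤ T →
      ENNReal.ofReal (c * (a / T / W x a)) ≤ meanInv (W x) a T ∧
        meanInv (W x) a T ≤ ENNReal.ofReal (C * (a / T / W x a)) := by
  obtain ⟨b, _, hb, _, hsc⟩ := hW.exists_mul_le_and_le_mul
  have hγ : 0 < γ₁ - 1 := by linarith
  refine ⟨1, b⁻¹ * (1 + (γ₁ - 1)⁻¹), one_pos, by positivity, fun x a T ha haT => ?_⟩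
  have hT := ha.trans_le haT
  have hWa := hW.pos x a ha
  have hint : IntervalIntegrable (fun r => b⁻¹ * a ^ γ₁ / W x a * max a r ^ (-γ₁)) volume 0 T :=
    (intervalIntegrable_max_rpow ha haT _).const_mul _
  have hle : ∀ r ∈ Ioc 0 T,
      1 / W x (max a r) ≤ b⁻¹ * a ^ γ₁ / W x a * max a r ^ (-γ₁) := fun r _ => by
    have hs : 0 < max a r := lt_max_of_lt_left ha
    have hscale := (hsc x a _ ha (le_max_left a r)).1
    have hWs := hW.pos x _ hs
    rw [Real.div_rpow hs.le ha.le] at hscale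
    rw [div_le_iff₀ hWs, Real.rpow_neg hs.le]
    calc 1 = b⁻¹ * a ^ γ₁ / W x a * (max a r ^ γ₁)⁻¹ *
          (b * (max a r ^ γ₁ / a ^ γ₁) * W x a) := by field_simp
      _ ≤ b⁻¹ * a ^ γ₁ / W x a * (max a r ^ γ₁)⁻¹ * W x (max a r) := by gcongr
  refine ⟨(one_mul (a / T / W x a)).symm ▸ ofReal_div_le_meanInv ha haT hWa, ?_⟩
  calc meanInv (W x) a T
      ≤ ENNReal.ofReal (T⁻¹ * ∫ r in 0..T, b⁻¹ * a ^ γ₁ / W x a * max a r ^ (-γ₁)) :=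
        meanInv_le_ofReal hT.le hint (fun r _ => by positivity) hle
    _ ≤ ENNReal.ofReal (T⁻¹ * (b⁻¹ * a ^ γ₁ / W x a * (a ^ (1 - γ₁) * (1 + (γ₁ - 1)⁻¹)))) := by
        rw [intervalIntegral.integral_const_mul]
        gcongr
        exact integral_max_rpow_le hγ₁ ha haT
    _ = ENNReal.ofReal (b⁻¹ * (1 + (γ₁ - 1)⁻¹) * (a / T / W x a)) := by
        rw [Real.rpow_sub ha, Real.rpow_one]
        field_simp

theorem WeakScalingUniformly.exists_one_add_log_le_meanInv
    (hW : WeakScalingUniformly W γ₁ γ₂) (hγ₁ : 1 ≤ γ₁) :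
    ∃ c : ℝ, 0 < c ∧ ∀ x a T, 0 < a → a ≤ T →
      ENNReal.ofReal (c * (1 / W x T * (1 + Real.log (T / a)))) ≤ meanInv (W x) a T := by
  obtain ⟨b, _, hb, _, hsc⟩ := hW.exists_mul_le_and_le_mul
  refine ⟨b, hb, fun x a T ha haT => ?_⟩
  have hT := ha.trans_le haT
  have hWT := hW.pos x T hT
  have hint : IntervalIntegrable (fun r => b * T / W x T * (max a r)⁻¹) volume 0 T :=
    (intervalIntegrable_inv_max ha haT).const_mul _
  have hle : ∀ r ∈ Ioc 0 T, b * T / W x T * (max a r)⁻¹ ≤ 1 / W x (max a r) := fun r hr => by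
    have hs : 0 < max a r := lt_max_of_lt_left ha
    have hsT : max a r ≤ T := max_le haT hr.2
    have hWs := hW.pos x _ hs
    rw [le_div_iff₀ hWs, div_mul_eq_mul_div, div_mul_eq_mul_div, div_le_one hWT]
    calc b * T * (max a r)⁻¹ * W x (max a r) = b * (T / max a r) ^ (1 : ℝ) * W x (max a r) := by
          rw [Real.rpow_one]
          ring
      _ ≤ b * (T / max a r) ^ γ₁ * W x (max a r) := by
          gcongr
          exact (one_le_div hs).2 hsT
      _ ≤ W x T := (hsc x _ T hs hsT).1
  calc ENNReal.ofReal (b * (1 / W x T * (1 + Real.log (T / a))))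
      = ENNReal.ofReal (T⁻¹ * ∫ r in 0..T, b * T / W x T * (max a r)⁻¹) := by
        rw [intervalIntegral.integral_const_mul, integral_inv_max ha haT]
        field_simp
    _ ≤ meanInv (W x) a T := ofReal_le_meanInv hT.le hint (fun r _ => by positivity) hle

theorem WeakScalingUniformly.exists_meanInv_le_one_add_log
    (hW : WeakScalingUniformly W γ₁ γ₂) (hγ₂ : γ₂ ≤ 1) :
    ∃ C : ℝ, 0 < C ∧ ∀ x a T, 0 < a → a ≤ T →
      meanInv (W x) a T ≤ ENNReal.ofReal (C * (1 / W x T * (1 + Real.log (T / a)))) := by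
  obtain ⟨_, b, _, hb, hsc⟩ := hW.exists_mul_le_and_le_mul
  refine ⟨b, hb, fun x a T ha haT => ?_⟩
  have hT := ha.trans_le haT
  have hWT := hW.pos x T hT
  have hint : IntervalIntegrable (fun r => b * T / W x T * (max a r)⁻¹) volume 0 T :=
    (intervalIntegrable_inv_max ha haT).const_mul _
  have hle : ∀ r ∈ Ioc 0 T, 1 / W x (max a r) ≤ b * T / W x T * (max a r)⁻¹ := fun r hr => by
    have hs : 0 < max a r := lt_max_of_lt_left ha
    have hsT : max a r ≤ T := max_le haT hr.2
    have hWs := hW.pos x _ hs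
    rw [div_le_iff₀ hWs, div_mul_eq_mul_div, div_mul_eq_mul_div, one_le_div hWT]
    calc W x T ≤ b * (T / max a r) ^ γ₂ * W x (max a r) := (hsc x _ T hs hsT).2
      _ ≤ b * (T / max a r) ^ (1 : ℝ) * W x (max a r) := by
          gcongr
          exact (one_le_div hs).2 hsT
      _ = b * T * (max a r)⁻¹ * W x (max a r) := by
          rw [Real.rpow_one]
          ring
  calc meanInv (W x) a T
      ≤ ENNReal.ofReal (T⁻¹ * ∫ r in 0..T, b * T / W x T * (max a r)⁻¹) :=
        meanInv_le_ofReal hT.le hint (fun r _ => by positivity) hle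
    _ = ENNReal.ofReal (b * (1 / W x T * (1 + Real.log (T / a)))) := by
        rw [intervalIntegral.integral_const_mul, integral_inv_max ha haT]
        field_simp

theorem WeakScalingUniformly.exists_meanInv_bounds_of_eq_one (hW : WeakScalingUniformly W 1 1) :
    ∃ c C : ℝ, 0 < c ∧ 0 < C ∧ ∀ x a T, 0 < a → a ≤ T →
      ENNReal.ofReal (c * (1 / W x T * Real.log (2 * (T / a)))) ≤ meanInv (W x) a T ∧
        meanInv (W x) a T ≤ ENNReal.ofReal (C * (1 / W x T * Real.log (2 * (T / a)))) := by
  obtain ⟨c, hc, hlow⟩ := hW.exists_one_add_log_le_meanInv le_rfl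
  obtain ⟨C, hC, hup⟩ := hW.exists_meanInv_le_one_add_log le_rfl
  have hlog2 : 0 < Real.log 2 := Real.log_pos one_lt_two
  have hlog2' : Real.log 2 ≤ 1 := by linarith [Real.log_two_lt_d9]
  refine ⟨c, C * (Real.log 2)⁻¹, hc, by positivity, fun x a T ha haT => ?_⟩
  have hWT := hW.pos x T (ha.trans_le haT)
  have hlog : 0 ≤ Real.log (T / a) := Real.log_nonneg ((one_le_div ha).2 haT)
  have hTa : T / a ≠ 0 := (div_pos (ha.trans_le haT) ha).ne'
  constructor
  · refine le_trans (ENNReal.ofReal_le_ofReal ?_) (hlow x a T ha haT)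
    rw [Real.log_mul two_ne_zero hTa]
    gcongr
  · refine (hup x a T ha haT).trans (ENNReal.ofReal_le_ofReal ?_)
    have hle : 1 + Real.log (T / a) ≤ (Real.log 2)⁻¹ * Real.log (2 * (T / a)) := by
      rw [Real.log_mul two_ne_zero hTa, mul_add, inv_mul_cancel₀ hlog2.ne']
      gcongr
      exact le_mul_of_one_le_left hlog ((one_le_inv₀ hlog2).2 hlog2')
    calc C * (1 / W x T * (1 + Real.log (T / a)))
        ≤ C * (1 / W x T * ((Real.log 2)⁻¹ * Real.log (2 * (T / a)))) := by gcongr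
      _ = C * (Real.log 2)⁻¹ * (1 / W x T * Real.log (2 * (T / a))) := by ring

theorem WeakScalingUniformly.meanInv_zero_eq_top (hW : WeakScalingUniformly W γ₁ γ₂)
    (hγ₁ : 1 ≤ γ₁) (x : Λ) {T : ℝ} (hT : 0 < T) : meanInv (W x) 0 T = ∞ := by
  obtain ⟨c, hc, hlow⟩ := hW.exists_one_add_log_le_meanInv hγ₁
  have hWT := hW.pos x T hT
  have hlim : Filter.Tendsto
      (fun n : ℝ => ENNReal.ofReal (c * (1 / W x T * (1 + n)))) Filter.atTop (nhds ∞) :=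
    ENNReal.tendsto_ofReal_atTop.comp <|
      ((Filter.tendsto_atTop_add_const_left _ 1 Filter.tendsto_id).const_mul_atTop
        (by positivity)).const_mul_atTop hc
  refine top_le_iff.1 (le_of_tendsto hlim ((Filter.eventually_ge_atTop 0).mono fun n hn => ?_))
  have ha : 0 < T * Real.exp (-n) := by positivity
  have hlog : Real.log (T / (T * Real.exp (-n))) = n := by
    rw [div_mul_cancel_left₀ hT.ne', ← Real.exp_neg, neg_neg, Real.log_exp]
  calc ENNReal.ofReal (c * (1 / W x T * (1 + n)))
      = ENNReal.ofReal (c * (1 / W x T * (1 + Real.log (T / (T * Real.exp (-n)))))) := by rw [hlog]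
    _ ≤ meanInv (W x) (T * Real.exp (-n)) T :=
        hlow x _ T ha (mul_le_of_le_one_right hT.le (Real.exp_le_one_iff.2 (neg_nonpos.2 hn)))
    _ ≤ meanInv (W x) 0 T := meanInv_anti (hW.mono x) (hW.pos x) ha.le

end Regimes

section Kernel

/-- The common content of the two heat kernel conditions, with `W x r = V(x, Φ⁻¹(r))` and
`τ x y = Φ(d(x, y))` the time scale on which the process travels from `x` to `y`: the kernel is
at most of order `1 / W x (τ x y ∨ r)`, and of order `1 / W x r` once `r` is at least of order
`τ x y`. -/
structure KernelBounds {M : Type*} (W : M → ℝ → ℝ) (τ : M → M → ℝ) (q : ℝ → M → M → ℝ) :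
    Prop where
  upper : ∃ C : ℝ, 0 < C ∧ ∀ r x y, 0 < r → q r x y ≤ C / W x (max (τ x y) r)
  lower : ∀ κ : ℝ, 0 < κ → ∃ c : ℝ, 0 < c ∧ ∀ r x y, 0 < r → τ x y ≤ κ * r → c / W x r ≤ q r x y

/-- The volume `V(x, Φ⁻¹(r))` of the ball explored from `x` up to time `r`. -/
noncomputable def timeVol {M : Type*} [MetricSpace M] [MeasurableSpace M] (μ : Measure M)
    (Φ : ℝ → ℝ) (x : M) (r : ℝ) : ℝ :=
  vol μ x (inv Φ r)

variable {M : Type*} [MetricSpace M] [MeasurableSpace M] {μ : Measure M} {q : ℝ → M → M → ℝ}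
  {Φ : ℝ → ℝ} {α₁ α₂ d₁ d₂ γ₁ γ₂ : ℝ}

theorem timeVol_apply (hΦ : StrictMonoOn Φ (Ici 0)) (x : M) {r : ℝ} (hr : 0 ≤ r) :
    timeVol μ Φ x (Φ r) = vol μ x r := by
  rw [timeVol, inv_apply hΦ hr]

theorem weakScalingUniformly_timeVol (hV : WeakScalingUniformly (vol μ) d₁ d₂)
    (h : WeakScaling Φ α₁ α₂) (h0 : Φ 0 = 0) :
    WeakScalingUniformly (timeVol μ Φ) (α₂⁻¹ * d₁) (α₁⁻¹ * d₂) :=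
  hV.comp (h.weakScaling_inv h0)

theorem jumpProfile_le (hW : WeakScalingUniformly (timeVol μ Φ) γ₁ γ₂)
    (hΦ : StrictMonoOn Φ (Ici 0)) (h0 : Φ 0 = 0) {r : ℝ} (hr : 0 < r) (x y : M) :
    jumpProfile μ Φ r x y ≤ 1 / timeVol μ Φ x (max (Φ (dist x y)) r) := by
  rcases le_total (Φ (dist x y)) r with hτ | hτ
  · rw [max_eq_right hτ, jumpProfile]
    split_ifs
    exacts [le_rfl, min_le_left _ _]
  · have hd : dist x y ≠ 0 := fun hd => hr.not_ge (h0 ▸ hd ▸ hτ)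
    have hτ0 : 0 < Φ (dist x y) := hr.trans_le hτ
    have hWτ := hW.pos x _ hτ0
    rw [max_eq_left hτ, jumpProfile, if_neg hd, ← timeVol_apply hΦ x dist_nonneg]
    refine (min_le_right _ _).trans ?_
    rw [mul_comm, ← div_div]
    gcongr
    exact (div_le_one hτ0).2 hτ

theorem exists_div_timeVol_le_jumpProfile (hW : WeakScalingUniformly (timeVol μ Φ) γ₁ γ₂)
    (h : WeakScaling Φ α₁ α₂) (hΦ : StrictMonoOn Φ (Ici 0)) (κ : ℝ) :
    ∃ c : ℝ, 0 < c ∧ ∀ r x y, 0 < r → Φ (dist x y) ≤ κ * r →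
      c / timeVol μ Φ x r ≤ jumpProfile μ Φ r x y := by
  obtain ⟨_, b, _, hb, hsc⟩ := hW.exists_mul_le_and_le_mul
  set κ' := max κ 1
  have hκ'1 : 1 ≤ κ' := le_max_right _ _
  have : 0 < κ' := one_pos.trans_le hκ'1
  refine ⟨min 1 (b * κ' ^ γ₂ * κ')⁻¹, by positivity, fun r x y hr hτ => ?_⟩
  have hWr := hW.pos x r hr
  have hdiag : min 1 (b * κ' ^ γ₂ * κ')⁻¹ / timeVol μ Φ x r ≤ 1 / timeVol μ Φ x r := by
    gcongr
    exact min_le_left _ _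
  rw [jumpProfile]
  split_ifs with hd
  · exact hdiag
  refine le_min hdiag ?_
  have hd0 : 0 < dist x y := lt_of_le_of_ne dist_nonneg (Ne.symm hd)
  have hτ0 := h.apply_pos hd0
  have hτκ' : Φ (dist x y) ≤ κ' * r := hτ.trans (by gcongr; exact le_max_left _ _)
  have hWτ : vol μ x (dist x y) ≤ b * κ' ^ γ₂ * timeVol μ Φ x r := by
    rw [← timeVol_apply hΦ x dist_nonneg]
    calc timeVol μ Φ x (Φ (dist x y)) ≤ timeVol μ Φ x (κ' * r) :=
          hW.mono x hτ0 (hτ0.trans_le hτκ') hτκ'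
      _ ≤ b * (κ' * r / r) ^ γ₂ * timeVol μ Φ x r :=
          (hsc x r _ hr (le_mul_of_one_le_left hr.le hκ'1)).2
      _ = b * κ' ^ γ₂ * timeVol μ Φ x r := by rw [mul_div_cancel_right₀ _ hr.ne']
  have hV0 : 0 < vol μ x (dist x y) := by
    rw [← timeVol_apply hΦ x dist_nonneg]
    exact hW.pos x _ hτ0
  calc min 1 (b * κ' ^ γ₂ * κ')⁻¹ / timeVol μ Φ x r
      ≤ (b * κ' ^ γ₂ * κ')⁻¹ / timeVol μ Φ x r := by
        gcongr
        exact min_le_right _ _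
    _ = r / (b * κ' ^ γ₂ * timeVol μ Φ x r * (κ' * r)) := by field_simp
    _ ≤ r / (vol μ x (dist x y) * Φ (dist x y)) := by gcongr

theorem JumpEstimate.kernelBounds (hq : JumpEstimate μ Φ q)
    (hW : WeakScalingUniformly (timeVol μ Φ) γ₁ γ₂) (h : WeakScaling Φ α₁ α₂)
    (hΦ : StrictMonoOn Φ (Ici 0)) (h0 : Φ 0 = 0) :
    KernelBounds (timeVol μ Φ) (fun x y => Φ (dist x y)) q := by
  obtain ⟨c₁, c₂, hc₁, hc₂, hq⟩ := hq
  refine ⟨⟨c₂, hc₂, fun r x y hr => ?_⟩, fun κ _ => ?_⟩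
  · calc q r x y ≤ c₂ * jumpProfile μ Φ r x y := (hq r x y hr).2
      _ ≤ c₂ * (1 / timeVol μ Φ x (max (Φ (dist x y)) r)) := by
        gcongr
        exact jumpProfile_le hW hΦ h0 hr x y
      _ = c₂ / timeVol μ Φ x (max (Φ (dist x y)) r) := mul_one_div _ _
  · obtain ⟨c, hc, hprofile⟩ := exists_div_timeVol_le_jumpProfile hW h hΦ κ
    refine ⟨c₁ * c, by positivity, fun r x y hr hτ => ?_⟩
    calc c₁ * c / timeVol μ Φ x r = c₁ * (c / timeVol μ Φ x r) := mul_div_assoc _ _ _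
      _ ≤ c₁ * jumpProfile μ Φ r x y := by
        gcongr
        exact hprofile r x y hr hτ
      _ ≤ q r x y := (hq r x y hr).1

variable {m : ℝ → ℝ → ℝ}

theorem IsStepFunction.nonneg (hm : IsStepFunction Φ m) {t r : ℝ} (ht : 0 < t) (hr : 0 ≤ r) :
    0 ≤ m t r := by
  rcases hr.eq_or_lt with rfl | hr
  exacts [(hm.zero t ht).ge, (hm.pos t r ht hr).le]

theorem IsStepFunction.exists_le_of_apply_le_mul (hm : IsStepFunction Φ m)
    (h : WeakScaling Φ α₁ α₂) (hα₁ : 1 < α₁) {κ : ℝ} (hκ : 0 < κ) :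
    ∃ A : ℝ, ∀ t r : ℝ, 0 < t → 0 ≤ r → Φ r ≤ κ * t → m t r ≤ A := by
  obtain ⟨c₁, _, hc₁, _, hsc⟩ := h.exists_mul_le_and_le_mul
  obtain ⟨_, b₂, _, hb₂, hstep⟩ := hm.scale
  refine ⟨max 1 ((κ * b₂ / c₁) ^ (α₁ - 1)⁻¹), fun t r ht hr hrt => ?_⟩
  rcases le_or_gt (m t r) 1 with hm1 | hm1
  · exact le_max_of_le_left hm1
  have hr0 : 0 < r := hr.lt_of_ne fun h0 => by
    rw [← h0, hm.zero t ht] at hm1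
    exact absurd hm1 (by norm_num)
  have hm0 := hm.pos t r ht hr0
  have hΦ0 : 0 < Φ (r / m t r) := h.apply_pos (by positivity)
  refine le_max_of_le_right ?_
  rw [Real.le_rpow_inv_iff_of_pos hm0.le (by positivity) (by linarith), le_div_iff₀' hc₁]
  refine le_of_mul_le_mul_right ?_ (mul_pos hm0 hΦ0)
  calc c₁ * m t r ^ (α₁ - 1) * (m t r * Φ (r / m t r))
      = c₁ * (r / (r / m t r)) ^ α₁ * Φ (r / m t r) := by
        rw [div_div_cancel₀ hr0.ne', Real.rpow_sub_one hm0.ne']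
        field_simp
    _ ≤ Φ r := (hsc () _ _ (by positivity) (div_le_self hr hm1.le)).1
    _ ≤ κ * (t / m t r * m t r) := by rwa [div_mul_cancel₀ _ hm0.ne']
    _ ≤ κ * (b₂ * Φ (r / m t r) * m t r) := by
        gcongr
        exact (hstep t r ht hr0).2
    _ = κ * b₂ * (m t r * Φ (r / m t r)) := by ring

theorem IsStepFunction.exists_apply_le_mul_one_add_rpow (hm : IsStepFunction Φ m)
    (h : WeakScaling Φ α₁ α₂) (hα₁ : 1 ≤ α₁) :
    ∃ K : ℝ, 0 < K ∧ ∀ t r : ℝ, 0 < t → 0 < r → Φ r ≤ K * (1 + m t r) ^ α₂ * t := by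
  obtain ⟨c₁, c₂, hc₁, hc₂, hsc⟩ := h.exists_mul_le_and_le_mul
  obtain ⟨b₁, _, hb₁, _, hstep⟩ := hm.scale
  refine ⟨max (c₂ / b₁) (c₁ * b₁)⁻¹, by positivity, fun t r ht hr => ?_⟩
  have hm0 := hm.pos t r ht hr
  have hα₂ : 1 ≤ α₂ := hα₁.trans h.left_le_right
  have hΦr : 0 < Φ r := h.apply_pos hr
  have hΦm0 : 0 < Φ (r / m t r) := h.apply_pos (by positivity)
  have hΦm : b₁ * Φ (r / m t r) ≤ t / m t r := (hstep t r ht hr).1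
  rcases le_total 1 (m t r) with hm1 | hm1
  · calc Φ r ≤ c₂ * (r / (r / m t r)) ^ α₂ * Φ (r / m t r) :=
          (hsc () _ _ (by positivity) (div_le_self hr.le hm1)).2
      _ = c₂ / b₁ * m t r ^ α₂ * (b₁ * Φ (r / m t r)) := by
          rw [div_div_cancel₀ hr.ne']
          field_simp
      _ ≤ max (c₂ / b₁) (c₁ * b₁)⁻¹ * (1 + m t r) ^ α₂ * t := by
          gcongr
          · exact le_max_left _ _
          · linarith
          · exact hΦm.trans (div_le_self ht.le hm1)
  · have hpow : m t r ^ α₁ ≤ m t r := by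
      simpa only [Real.rpow_one] using Real.rpow_le_rpow_of_exponent_ge hm0 hm1 hα₁
    have hlower := (hsc () r (r / m t r) hr (le_div_self hr.le hm0 hm1)).1
    rw [div_div_cancel_left' hr.ne', Real.inv_rpow hm0.le] at hlower
    calc Φ r = m t r ^ α₁ * (c₁ * (m t r ^ α₁)⁻¹ * Φ r) * c₁⁻¹ := by field_simp
      _ ≤ m t r * Φ (r / m t r) * c₁⁻¹ := by gcongr
      _ = (c₁ * b₁)⁻¹ * 1 * (m t r * (b₁ * Φ (r / m t r))) := by field_simp
      _ ≤ max (c₂ / b₁) (c₁ * b₁)⁻¹ * (1 + m t r) ^ α₂ * t := by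
          gcongr
          · exact le_max_right _ _
          · exact Real.one_le_rpow (by linarith) (by linarith)
          · exact (le_div_iff₀' hm0).1 hΦm

theorem exists_one_add_rpow_mul_exp_neg_le (d : ℝ) {a : ℝ} (ha : 0 < a) :
    ∃ L : ℝ, ∀ z : ℝ, 0 ≤ z → (1 + z) ^ d * Real.exp (-(a * z)) ≤ L := by
  set n := ⌈d⌉₊
  refine ⟨n.factorial / a ^ n * Real.exp a, fun z hz => ?_⟩
  have hpow : (1 + z) ^ d ≤ (1 + z) ^ n := by
    rw [← Real.rpow_natCast]
    exact Real.rpow_le_rpow_of_exponent_le (by linarith) (Nat.le_ceil d)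
  have hexp := Real.pow_div_factorial_le_exp (a * (1 + z)) (by positivity) n
  rw [div_le_iff₀' (by positivity), mul_pow, ← le_div_iff₀' (by positivity)] at hexp
  calc (1 + z) ^ d * Real.exp (-(a * z))
      ≤ n.factorial * Real.exp (a * (1 + z)) / a ^ n * Real.exp (-(a * z)) := by
        gcongr
        exact hpow.trans hexp
    _ = n.factorial / a ^ n * Real.exp a := by
        rw [mul_add, mul_one, Real.exp_add, Real.exp_neg]
        field_simp

theorem exists_mul_exp_neg_le_div_timeVol (hm : IsStepFunction Φ m)
    (hW : WeakScalingUniformly (timeVol μ Φ) γ₁ γ₂) (h : WeakScaling Φ α₁ α₂) (h0 : Φ 0 = 0)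
    (hα₁ : 1 ≤ α₁) {a : ℝ} (ha : 0 < a) :
    ∃ C : ℝ, 0 < C ∧ ∀ r x y, 0 < r →
      1 / timeVol μ Φ x r * Real.exp (-(a * m r (dist x y))) ≤
        C / timeVol μ Φ x (max (Φ (dist x y)) r) := by
  obtain ⟨_, b, _, hb, hsc⟩ := hW.exists_mul_le_and_le_mul
  obtain ⟨K, hK, hKm⟩ := hm.exists_apply_le_mul_one_add_rpow h hα₁
  obtain ⟨L, hLm⟩ := exists_one_add_rpow_mul_exp_neg_le (α₂ * γ₂) ha
  refine ⟨max 1 (b * K ^ γ₂ * L), by positivity, fun r x y hr => ?_⟩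
  have hm0 : 0 ≤ m r (dist x y) := hm.nonneg hr dist_nonneg
  have hWr := hW.pos x r hr
  have hγ₂ := hW.pos_right
  rcases le_or_gt (Φ (dist x y)) r with hτ | hτ
  · rw [max_eq_right hτ, ← mul_div_right_comm, one_mul]
    gcongr
    exact le_max_of_le_left (Real.exp_le_one_iff.2 (neg_nonpos.2 (by positivity)))
  · have hd : 0 < dist x y := dist_nonneg.lt_of_ne fun hd => by
      rw [← hd, h0] at hτ
      exact hr.not_gt hτ
    have hτ0 := hr.trans hτ
    have hτr := (div_le_iff₀ hr).2 (hKm r _ hr hd)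
    rw [max_eq_left hτ.le, le_div_iff₀ (hW.pos x _ hτ0)]
    calc 1 / timeVol μ Φ x r * Real.exp (-(a * m r (dist x y))) * timeVol μ Φ x (Φ (dist x y))
        ≤ 1 / timeVol μ Φ x r * Real.exp (-(a * m r (dist x y))) *
            (b * (Φ (dist x y) / r) ^ γ₂ * timeVol μ Φ x r) := by
          gcongr
          exact (hsc x _ _ hr hτ.le).2
      _ = b * (Φ (dist x y) / r) ^ γ₂ * Real.exp (-(a * m r (dist x y))) := by field_simp
      _ ≤ b * (K * (1 + m r (dist x y)) ^ α₂) ^ γ₂ * Real.exp (-(a * m r (dist x y))) := by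
          gcongr
      _ = b * K ^ γ₂ * ((1 + m r (dist x y)) ^ (α₂ * γ₂) * Real.exp (-(a * m r (dist x y)))) := by
          rw [Real.mul_rpow hK.le (by positivity), Real.rpow_mul (by positivity)]
          ring
      _ ≤ max 1 (b * K ^ γ₂ * L) := by
          refine le_max_of_le_right ?_
          gcongr
          exact hLm _ hm0

theorem DiffusionEstimate.kernelBounds (hq : DiffusionEstimate μ Φ q)
    (hW : WeakScalingUniformly (timeVol μ Φ) γ₁ γ₂) (h : WeakScaling Φ α₁ α₂) (h0 : Φ 0 = 0)
    (hα₁ : 1 < α₁) : KernelBounds (timeVol μ Φ) (fun x y => Φ (dist x y)) q := by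
  obtain ⟨m, hm, c₁, c₂, c₃, c₄, hc₁, hc₂, hc₃, hc₄, hq⟩ := hq
  refine ⟨?_, fun κ hκ => ?_⟩
  · obtain ⟨C, hC, hexp⟩ := exists_mul_exp_neg_le_div_timeVol hm hW h h0 hα₁.le hc₄
    refine ⟨c₃ * C, by positivity, fun r x y hr => ?_⟩
    calc q r x y ≤ c₃ / vol μ x (inv Φ r) * Real.exp (-c₄ * m r (dist x y)) := (hq r x y hr).2
      _ = c₃ * (1 / timeVol μ Φ x r * Real.exp (-(c₄ * m r (dist x y)))) := by
        rw [timeVol, neg_mul]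
        ring
      _ ≤ c₃ * (C / timeVol μ Φ x (max (Φ (dist x y)) r)) := by
        gcongr
        exact hexp r x y hr
      _ = c₃ * C / timeVol μ Φ x (max (Φ (dist x y)) r) := (mul_div_assoc _ _ _).symm
  · obtain ⟨A, hmA⟩ := hm.exists_le_of_apply_le_mul h hα₁ hκ
    refine ⟨c₁ * Real.exp (-c₂ * A), by positivity, fun r x y hr hτ => ?_⟩
    have hWr := hW.pos x r hr
    calc c₁ * Real.exp (-c₂ * A) / timeVol μ Φ x r
        = c₁ / timeVol μ Φ x r * Real.exp (-c₂ * A) := mul_div_right_comm _ _ _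
      _ ≤ c₁ / timeVol μ Φ x r * Real.exp (-c₂ * m r (dist x y)) := by
        gcongr _ * Real.exp ?_
        exact mul_le_mul_of_nonpos_left (hmA r _ hr dist_nonneg hτ) (by linarith)
      _ ≤ q r x y := (hq r x y hr).1

end Kernel

section Comparison

variable {M Ω : Type*} [MeasurableSpace Ω] {P : Measure Ω} [IsProbabilityMeasure P]
  {S : ℝ≥0 → Ω → ℝ} {W : M → ℝ → ℝ} {τ : M → M → ℝ} {q : ℝ → M → M → ℝ} {φ : ℝ → ℝ}
  {α₁ α₂ β₁ β₂ : ℝ}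

theorem KernelBounds.exists_fundamentalSolution_bounds (hq : KernelBounds W τ q)
    (hW : ∀ x, MonotoneOn (W x) (Ioi 0)) (hW0 : ∀ x r, 0 < r → 0 < W x r)
    (hτ : ∀ x y, 0 ≤ τ x y) (hS : IsSubordinator P S) (hφ : IsLaplaceExponent P S φ)
    (hφs : WeakScaling φ β₁ β₂) (hβ₂ : β₂ < 1) :
    ∃ k K : ℝ, 0 < k ∧ 0 < K ∧ ∀ t x y, 0 < t → τ x y * φ t⁻¹ ≤ 1 →
      ENNReal.ofReal k * meanInv (W x) (τ x y) (1 / φ t⁻¹) ≤ fundamentalSolution hS q t x y ∧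
        fundamentalSolution hS q t x y ≤
          ENNReal.ofReal K * meanInv (W x) (τ x y) (1 / φ t⁻¹) := by
  obtain ⟨c, C, hc, hC, hν⟩ := hφ.exists_stieltjes_measure_Ioc_mem_Icc hS hφs hβ₂
  obtain ⟨K, hK, hup⟩ := hq.upper
  obtain ⟨k, hk, hlow⟩ := hq.lower (2 * C / c) (by positivity)
  refine ⟨k * (c / 2), K * C, by positivity, by positivity, fun t x y ht hxy => ?_⟩
  have hφt : 0 < φ t⁻¹ := hφs.apply_pos (by positivity)
  have hν' : ∀ r, 0 ≤ r → (hS.monotone_tail t).stieltjesFunction.measure (Ioc 0 r) ∈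
      Icc (ENNReal.ofReal (c * min (r / (1 / φ t⁻¹)) 1))
        (ENNReal.ofReal (C * min (r / (1 / φ t⁻¹)) 1)) := fun r hr => by
    rw [one_div, div_inv_eq_mul]
    exact hν t r ht hr
  exact ⟨meanInv_le_lintegral (hW x) (hW0 x) (one_div_pos.2 hφt) hc hC hν' (hτ x y)
      ((le_div_iff₀ hφt).2 hxy) hk.le fun r hr => hlow r x y hr,
    lintegral_le_meanInv (hW x) (hW0 x) (one_div_pos.2 hφt) hC.le (fun r hr => (hν' r hr).2) hK.le
      fun r hr => hup r x y hr⟩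

theorem Comparable.of_mul_le_of_le_mul {D : ℝ → M → M → Prop} {p A : ℝ → M → M → ℝ≥0∞}
    {f : ℝ → M → M → ℝ} {k K : ℝ} (hA : Comparable D A f) (hk : 0 < k) (hK : 0 < K)
    (hp : ∀ t x y, D t x y →
      ENNReal.ofReal k * A t x y ≤ p t x y ∧ p t x y ≤ ENNReal.ofReal K * A t x y) :
    Comparable D p f := by
  obtain ⟨c, C, hc, hC, hA⟩ := hA
  refine ⟨k * c, K * C, by positivity, by positivity, fun t x y hD => ?_⟩
  rw [mul_assoc, mul_assoc, ENNReal.ofReal_mul hk.le, ENNReal.ofReal_mul hK.le]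
  exact ⟨(mul_le_mul_right (hA t x y hD).1 _).trans (hp t x y hD).1,
    (hp t x y hD).2.trans (mul_le_mul_right (hA t x y hD).2 _)⟩

variable [MetricSpace M] [MeasurableSpace M] {μ : Measure M} {Φ : ℝ → ℝ} {γ₁ γ₂ : ℝ}

theorem comparable_meanInv_of_right_lt_one (hW : WeakScalingUniformly (timeVol μ Φ) γ₁ γ₂)
    (hγ₂ : γ₂ < 1) (hΦs : WeakScaling Φ α₁ α₂) (hΦ0 : Φ 0 = 0) (hφs : WeakScaling φ β₁ β₂) :
    Comparable (fun t x y => 0 < t ∧ Φ (dist x y) * φ t⁻¹ ≤ 1)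
      (fun t x y => meanInv (timeVol μ Φ x) (Φ (dist x y)) (1 / φ t⁻¹))
      (fun t x _ => 1 / vol μ x (inv Φ (1 / φ t⁻¹))) := by
  obtain ⟨c, C, hc, hC, hmean⟩ := hW.exists_meanInv_bounds_of_right_lt_one hγ₂
  refine ⟨c, C, hc, hC, fun t x y ⟨ht, hxy⟩ => ?_⟩
  have hφt : 0 < φ t⁻¹ := hφs.apply_pos (by positivity)
  exact hmean x _ _ (hΦs.apply_nonneg hΦ0 dist_nonneg) ((le_div_iff₀ hφt).2 hxy) (by positivity)

theorem comparable_meanInv_of_one_lt_left (hW : WeakScalingUniformly (timeVol μ Φ) γ₁ γ₂)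
    (hγ₁ : 1 < γ₁) (hΦ : StrictMonoOn Φ (Ici 0)) (hΦs : WeakScaling Φ α₁ α₂)
    (hφs : WeakScaling φ β₁ β₂) :
    Comparable (fun t x y => 0 < t ∧ x ≠ y ∧ Φ (dist x y) * φ t⁻¹ ≤ 1)
      (fun t x y => meanInv (timeVol μ Φ x) (Φ (dist x y)) (1 / φ t⁻¹))
      (fun t x y => Φ (dist x y) * φ t⁻¹ / vol μ x (dist x y)) := by
  obtain ⟨c, C, hc, hC, hmean⟩ := hW.exists_meanInv_bounds_of_one_lt_left hγ₁
  refine ⟨c, C, hc, hC, fun t x y ⟨ht, hne, hxy⟩ => ?_⟩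
  have hφt : 0 < φ t⁻¹ := hφs.apply_pos (by positivity)
  have hτ : 0 < Φ (dist x y) := hΦs.apply_pos (dist_pos.2 hne)
  have hbounds := hmean x _ _ hτ ((le_div_iff₀ hφt).2 hxy)
  rwa [timeVol_apply hΦ x dist_nonneg, div_div_eq_mul_div, div_one] at hbounds

theorem comparable_meanInv_of_eq_one (hW : WeakScalingUniformly (timeVol μ Φ) 1 1)
    (hΦs : WeakScaling Φ α₁ α₂) (hφs : WeakScaling φ β₁ β₂) :
    Comparable (fun t x y => 0 < t ∧ x ≠ y ∧ Φ (dist x y) * φ t⁻¹ ≤ 1)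
      (fun t x y => meanInv (timeVol μ Φ x) (Φ (dist x y)) (1 / φ t⁻¹))
      (fun t x y => 1 / vol μ x (inv Φ (1 / φ t⁻¹)) *
        Real.log (2 / (Φ (dist x y) * φ t⁻¹))) := by
  obtain ⟨c, C, hc, hC, hmean⟩ := hW.exists_meanInv_bounds_of_eq_one
  refine ⟨c, C, hc, hC, fun t x y ⟨ht, hne, hxy⟩ => ?_⟩
  have hφt : 0 < φ t⁻¹ := hφs.apply_pos (by positivity)
  have hτ : 0 < Φ (dist x y) := hΦs.apply_pos (dist_pos.2 hne)
  have hbounds := hmean x _ _ hτ ((le_div_iff₀ hφt).2 hxy)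
  rwa [div_div, mul_comm (φ t⁻¹), mul_one_div] at hbounds

end Comparison

theorem corollary5p3_general
    {M : Type*} [MetricSpace M] [MeasurableSpace M] (μ : Measure M)
    (d₁ d₂ : ℝ) (hV : WeakScalingUniformly (vol μ) d₁ d₂)
    {Ω : Type*} [MeasurableSpace Ω] (P : Measure Ω) [IsProbabilityMeasure P]
    (S : ℝ≥0 → Ω → ℝ) (hS : IsSubordinator P S) (φ : ℝ → ℝ) (hφ : IsLaplaceExponent P S φ)
    (β₁ β₂ : ℝ) (hβ₂ : β₂ < 1) (hφs : WeakScaling φ β₁ β₂) (q : ℝ → M → M → ℝ)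
    (Φ : ℝ → ℝ) (hΦ : StrictMonoOn Φ (Ici 0)) (hΦ0 : Φ 0 = 0)
    (α₁ α₂ : ℝ) (hΦs : WeakScaling Φ α₁ α₂)
    (hest : JumpEstimate μ Φ q ∨ 1 < α₁ ∧ DiffusionEstimate μ Φ q) :
    (d₂ < α₁ →
      Comparable (fun t x y => 0 < t ∧ Φ (dist x y) * φ t⁻¹ ≤ 1) (fundamentalSolution hS q)
        (fun t x _ => 1 / vol μ x (inv Φ (1 / φ t⁻¹)))) ∧
    (α₂ < d₁ →
      Comparable (fun t x y => 0 < t ∧ x ≠ y ∧ Φ (dist x y) * φ t⁻¹ ≤ 1)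
        (fundamentalSolution hS q)
        (fun t x y => Φ (dist x y) * φ t⁻¹ / vol μ x (dist x y)) ∧
      ∀ (t : ℝ) (x : M), 0 < t → fundamentalSolution hS q t x x = ∞) ∧
    (d₁ = d₂ → d₂ = α₁ → α₁ = α₂ →
      Comparable (fun t x y => 0 < t ∧ x ≠ y ∧ Φ (dist x y) * φ t⁻¹ ≤ 1)
        (fundamentalSolution hS q)
        (fun t x y => 1 / vol μ x (inv Φ (1 / φ t⁻¹)) *
          Real.log (2 / (Φ (dist x y) * φ t⁻¹))) ∧
      ∀ (t : ℝ) (x : M), 0 < t → fundamentalSolution hS q t x x = ∞) := by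
  have hW := weakScalingUniformly_timeVol hV hΦs hΦ0
  have hkernel : KernelBounds (timeVol μ Φ) (fun x y => Φ (dist x y)) q :=
    hest.elim (fun hJ => hJ.kernelBounds hW hΦs hΦ hΦ0)
      fun ⟨hα₁, hD⟩ => hD.kernelBounds hW hΦs hΦ0 hα₁
  obtain ⟨k, K, hk, hK, hp⟩ := hkernel.exists_fundamentalSolution_bounds hW.mono hW.pos
    (fun x y => hΦs.apply_nonneg hΦ0 dist_nonneg) hS hφ hφs hβ₂
  have hdiag (hγ : 1 ≤ α₂⁻¹ * d₁) (t : ℝ) (x : M) (ht : 0 < t) :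
      fundamentalSolution hS q t x x = ∞ := by
    have hφt : 0 < φ t⁻¹ := hφs.apply_pos (inv_pos.2 ht)
    have hlow := (hp t x x ht (by simp [hΦ0])).1
    simp only [dist_self, hΦ0] at hlow
    rwa [hW.meanInv_zero_eq_top hγ x (by positivity), ENNReal.mul_top (by simpa using hk),
      top_le_iff] at hlow
  have hα₁ : 0 < α₁ := hΦs.pos_left
  have hα₂ : 0 < α₂ := hΦs.pos_right
  refine ⟨fun hlt => ?_, fun hlt => ?_, ?_⟩
  · exact (comparable_meanInv_of_right_lt_one hW ((inv_mul_lt_one₀ hα₁).2 hlt) hΦs hΦ0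
      hφs).of_mul_le_of_le_mul hk hK fun t x y ⟨ht, hxy⟩ => hp t x y ht hxy
  · have hγ : 1 < α₂⁻¹ * d₁ := (one_lt_inv_mul₀ hα₂).2 hlt
    exact ⟨(comparable_meanInv_of_one_lt_left hW hγ hΦ hΦs hφs).of_mul_le_of_le_mul hk hK
      fun t x y ⟨ht, _, hxy⟩ => hp t x y ht hxy, hdiag hγ.le⟩
  · rintro rfl rfl rfl
    rw [inv_mul_cancel₀ hα₁.ne'] at hW hdiag
    exact ⟨(comparable_meanInv_of_eq_one hW hΦs hφs).of_mul_le_of_le_mul hk hK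
      fun t x y ⟨ht, _, hxy⟩ => hp t x y ht hxy, hdiag le_rfl⟩

end TimeFractional

theorem corollary5p3
    {M : Type*} [MetricSpace M] [LocallyCompactSpace M] [TopologicalSpace.SeparableSpace M]
    [MeasurableSpace M] [BorelSpace M]
    (μ : Measure M) [μ.Regular] [μ.IsOpenPosMeasure]
    -- volume scaling
    (d₁ d₂ : ℝ) (hV : TimeFractional.WeakScalingUniformly (TimeFractional.vol μ) d₁ d₂)
    -- the subordinator and its Laplace exponent
    {Ω : Type*} [MeasurableSpace Ω] (P : Measure Ω) [IsProbabilityMeasure P]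
    (S : ℝ≥0 → Ω → ℝ) (hS : TimeFractional.IsSubordinator P S)
    (φ : ℝ → ℝ) (hφ : TimeFractional.IsDriftlessLaplaceExponent P S φ)
    (β₁ β₂ : ℝ) (hβ₂ : β₂ < 1) (hφs : TimeFractional.WeakScaling φ β₁ β₂)
    -- the strong Markov process and its heat kernel
    {Ω' : Type*} {mΩ' : MeasurableSpace Ω'} (ℱ : Filtration ℝ≥0 mΩ') (Q : M → Measure Ω')
    (X : ℝ≥0 → Ω' → M) (hX : TimeFractional.IsStrongMarkovProcess ℱ Q X)
    (q : ℝ → M → M → ℝ) (hq : TimeFractional.IsHeatKernel μ Q X q)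
    -- the scale function
    (Φ : ℝ → ℝ) (hΦ : StrictMonoOn Φ (Ici 0)) (hΦ0 : Φ 0 = 0)
    (α₁ α₂ : ℝ) (hΦs : TimeFractional.WeakScaling Φ α₁ α₂)
    (hest : TimeFractional.JumpEstimate μ Φ q ∨ TimeFractional.DiffusionCase μ Q X Φ α₁ q) :
    (d₂ < α₁ →
      TimeFractional.Comparable
        (fun t x y => 0 < t ∧ Φ (dist x y) * φ t⁻¹ ≤ 1)
        (TimeFractional.fundamentalSolution hS q)
        (fun t x _ => 1 / TimeFractional.vol μ x (TimeFractional.inv Φ (1 / φ t⁻¹)))) ∧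
    (α₂ < d₁ →
      TimeFractional.Comparable
        (fun t x y => 0 < t ∧ x ≠ y ∧ Φ (dist x y) * φ t⁻¹ ≤ 1)
        (TimeFractional.fundamentalSolution hS q)
        (fun t x y => Φ (dist x y) * φ t⁻¹ / TimeFractional.vol μ x (dist x y)) ∧
      ∀ (t : ℝ) (x : M), 0 < t → TimeFractional.fundamentalSolution hS q t x x = ∞) ∧
    (d₁ = d₂ → d₂ = α₁ → α₁ = α₂ →
      TimeFractional.Comparable
        (fun t x y => 0 < t ∧ x ≠ y ∧ Φ (dist x y) * φ t⁻¹ ≤ 1)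
        (TimeFractional.fundamentalSolution hS q)
        (fun t x y => 1 / TimeFractional.vol μ x (TimeFractional.inv Φ (1 / φ t⁻¹)) *
          Real.log (2 / (Φ (dist x y) * φ t⁻¹))) ∧
      ∀ (t : ℝ) (x : M), 0 < t → TimeFractional.fundamentalSolution hS q t x x = ∞) :=
  TimeFractional.corollary5p3_general μ d₁ d₂ hV P S hS φ hφ.laplace β₁ β₂ hβ₂ hφs q Φ hΦ hΦ0 α₁ α₂
    hΦs (hest.imp_right fun h => ⟨h.one_lt, h.estimate⟩)
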